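/- Let $k$ be a field of characteristic zero, $W$ a smooth scheme over $k$ (not necessarily connected), $J\subset\mathcal{O}_W$ a (quasi-coherent) sheaf of ideals and $b\ge 1$ an integer. For $x\in W$ let $\mathrm{ord}_J(x)$ be the order of $J_x$ in the local ring $\mathcal{O}_{W,x}$, i.e. the largest $n$ with $J_x\subset \mathfrak{m}_x^n$ ($\infty$ if $J_x=0$), and let $\mathrm{Sing}(J,b)=\{x\in W : \mathrm{ord}_J(x)\ge b\}$. The couple $(J,b)$ is called simple if $b$ is the maximum value of the function $\mathrm{ord}_J$ on $W$ (so that in particular $J_x\ne 0$ for all $x\in W$). A transformation $(W,(J,b))\leftarrow (W_1,(J_1,b))$ is given by a closed subscheme $Y\subset W$, smooth over $k$ and contained in $\mathrm{Sing}(J,b)$, the blow-up $\pi:W_1\to W$ of $W$ along $Y$, and the sheaf of ideals $J_1\subset\mathcal{O}_{W_1}$ with $J\mathcal{O}_{W_1}=I(H)^b\cdot J_1$, where $I(H)=I(Y)\mathcal{O}_{W_1}$ is the ideal of the exceptional hypersurface $H=\pi^{-1}(Y)$. Assume that $(J,b)$ is a simple couple. Then: (1) for every transformation $(W,(J,b))\leftarrow(W_1,(J_1,b))$,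 either $\mathrm{Sing}(J_1,b)=\emptyset$ or $(J_1,b)$ is again a simple couple (on the smooth $k$-scheme $W_1$); (2) for every finite sequence of transformations $$(W,(J,b))\leftarrow (W_1,(J_1,b))\leftarrow\cdots\leftarrow (W_r,(J_r,b)),$$ the function $\mathrm{ord}_{J_r}$ on $W_r$ has a maximum, and this maximum is at most $b$; (3) if $b=1$, then in the situation of (2) the maximum order of $J_r$ is either $1$ or $0$, and in the latter case $J_r=\mathcal{O}_{W_r}$. -/

import Mathlib

universe u

open CategoryTheory AlgebraicGeometry

noncomputable section

namespace SimpleCouples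

/-- The stalk `J_x` of an ideal sheaf `J` at `x`: the ideal of the local ring at `x` generated by
the germs of the sections of `J` over the affine open neighbourhoods of `x`. -/
def stalkIdeal {X : Scheme.{u}} (J : X.IdealSheafData) (x : X) : Ideal (X.presheaf.stalk x) :=
  ⨆ (U : X.affineOpens) (hx : x ∈ U.1), (J.ideal U).map (X.presheaf.germ U.1 x hx).hom

/-- The order of `J` at `x`: the supremum in `ℕ∞` of all `n` such that `J_x` is contained in the
`n`-th power of the maximal ideal of the local ring at `x`
(it is `⊤` if `J_x = 0`, and `0` if `J_x` is the whole local ring). -/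
def ordAt {X : Scheme.{u}} (J : X.IdealSheafData) (x : X) : ℕ∞ :=
  ⨆ (n : ℕ) (_ : stalkIdeal J x ≤ IsLocalRing.maximalIdeal (X.presheaf.stalk x) ^ n), (n : ℕ∞)

/-- `Sing(J, b)`: the set of points at which `J` has order at least `b`. -/
def Sing {X : Scheme.{u}} (J : X.IdealSheafData) (b : ℕ) : Set X :=
  {x | (b : ℕ∞) ≤ ordAt J x}

/-- `m` is the maximum value achieved by the function `x ↦ ord_x(J)`. -/
def HasMaxOrder {X : Scheme.{u}} (J : X.IdealSheafData) (m : ℕ) : Prop :=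
  IsGreatest (Set.range (ordAt J)) (m : ℕ∞)

/-- `I` is an invertible sheaf of ideals (the ideal of an effective Cartier divisor): locally it is
generated by one section, which is not a zero divisor. -/
def IsInvertibleIdeal {X : Scheme.{u}} (I : X.IdealSheafData) : Prop :=
  ∀ x : X, ∃ U : X.affineOpens, x ∈ U.1 ∧
    ∃ f ∈ nonZeroDivisors Γ(X, U.1), I.ideal U = Ideal.span {f}

/-- `π : X₁ ⟶ X` is the blow-up (monoidal transformation) of `X` along the closed subscheme defined
by `I`: the total transform `I · 𝒪_{X₁}` is invertible, and `π` is universal with this property.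
(`I.comap π` is the ideal sheaf `I · 𝒪_{X₁}`, the ideal of the scheme-theoretic preimage.) -/
structure IsBlowup {X₁ X : Scheme.{u}} (π : X₁ ⟶ X) (I : X.IdealSheafData) : Prop where
  invertible : IsInvertibleIdeal (I.comap π)
  existsUnique_lift : ∀ {Z : Scheme.{u}} (g : Z ⟶ X), IsInvertibleIdeal (I.comap g) →
    ∃! g₁ : Z ⟶ X₁, g₁ ≫ π = g

/-- A scheme over a field `k` together with a (quasi-coherent) sheaf of ideals. -/
structure SchemeWithIdeal (k : Type u) [Field k] where
  /-- the ambient scheme `W` -/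
  W : Scheme.{u}
  /-- the structure morphism of `W` over `k` -/
  str : W ⟶ Spec (CommRingCat.of k)
  /-- the ideal sheaf `J ⊆ 𝒪_W` -/
  J : W.IdealSheafData

variable {k : Type u} [Field k]

/-- `(J, b)` is a simple couple: `W` is smooth over `k`, `b` is a positive integer and `b` is the
maximum order of `J`. As `b` is finite, this entails `J_x ≠ 0` for every point `x` of `W`. -/
def IsSimpleCouple (b : ℕ) (C : SchemeWithIdeal k) : Prop :=
  Smooth C.str ∧ 0 < b ∧ HasMaxOrder C.J b

/-- `(W, (J, b)) ← (W₁, (J₁, b))` is a transformation: for some closed subscheme `Y` of `W`, with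
ideal sheaf `I`, that is smooth over `k` and contained in `Sing(J, b)`, `W₁` is the blow-up of `W`
along `Y`, and `J · 𝒪_{W₁} = I(H)^b · J₁`, where `I(H) = I · 𝒪_{W₁}` is the ideal sheaf of the
exceptional hypersurface `H = π⁻¹(Y)`. -/
def IsTransform (b : ℕ) (C C₁ : SchemeWithIdeal k) : Prop :=
  ∃ (π : C₁.W ⟶ C.W) (I : C.W.IdealSheafData),
    π ≫ C.str = C₁.str ∧
    Smooth (I.subschemeι ≫ C.str) ∧
    (I.support : Set C.W) ⊆ Sing C.J b ∧
    IsBlowup π I ∧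
    C.J.comap π = (I.comap π) ^ b * C₁.J

/-- `C'` is obtained from `C` by a finite (possibly empty) sequence of transformations
`W ← W₁ ← ⋯ ← W_r` of couples `(J, b), (J₁, b), …, (J_r, b)`. -/
def IsIteratedTransform (b : ℕ) (C C' : SchemeWithIdeal k) : Prop :=
  Relation.ReflTransGen (IsTransform b) C C'

end SimpleCouples

end

/-! ### Ideal sheaves under pullback, their stalks and their orders. -/

noncomputable section
namespace SimpleCouples

/-! The invariant to carry along is `HasOrderAtMost`: the scheme is smooth and nonempty, and the
order is at most `b` everywhere. The order then takes finitely many values, so it has a maximum,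
equal to `b` as soon as `Sing` is nonempty; and order zero everywhere forces the unit ideal.
Everything thus reduces to one transformation preserving the invariant.

The core is the order bound `IsBlowupChart.exists_notMem_pow`. Near a point of the centre take
coordinates `x` generating its ideal, and put `t j = x j / x i` on the `i`-th chart. Let `p` be the
image of a point of the chart, and `f ∈ J` outside `p ^ (b + 1)`. As `f = x i ^ b * g` with `g ∈
J₁`, the element `f` is a form `F` of degree `b` in `x`, and `g = F(t)`. Modulo `p` the chart
becomes the polynomial ring over `A ⧸ p` in the `t j`, `j ≠ i`, and `g` becomes the dehomogenization
of `F`, nonzero since otherwise `f ∈ p ^ (b + 1)`. Over a domain of characteristic zero, a nonzero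
polynomial of degree at most `b` has order at most `b` at every prime lying over zero: differentiate
until a nonzero constant remains.

Blow-ups are known only through their universal property. Coordinates make `k[X] → A` smooth
(`exists_smooth_coordinates`), so charts of affine space base change to smooth charts
(`exists_isBlowupChart`), and `IsBlowup.comp_lift_eq_and_isOpenImmersion` identifies open pieces of
the blow-up with open pieces of charts. Nonemptiness is threatened only by a centre that is open
near one of its points; there `J` would vanish generically and have infinite order. -/

/-- The ideal of `A` defined by the pull back of `J` to `Spec A`. -/
def idealOn {A : CommRingCat.{u}} {X : Scheme.{u}} (f : Spec A ⟶ X) (J : X.IdealSheafData) :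
    Ideal A :=
  ((J.comap f).ideal ⟨⊤, isAffineOpen_top _⟩).map (Scheme.ΓSpecIso A).hom.hom

/-- Both inclusions come from the adjunction between `comap` and `map`, tested on the ideal sheaf of
the extended ideal. -/
lemma comap_ideal_top {X Y : Scheme.{u}} [IsAffine X] [IsAffine Y] (f : X ⟶ Y)
    (J : Y.IdealSheafData) :
    (J.comap f).ideal ⟨⊤, isAffineOpen_top _⟩ =
      (J.ideal ⟨⊤, isAffineOpen_top _⟩).map f.appTop.hom := by
  apply le_antisymm
  · let K := Scheme.IdealSheafData.ofIdealTop
      ((J.ideal ⟨⊤, isAffineOpen_top _⟩).map f.appTop.hom)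
    have hK : K.ideal ⟨⊤, isAffineOpen_top _⟩ =
        (J.ideal ⟨⊤, isAffineOpen_top _⟩).map f.appTop.hom :=
      Scheme.IdealSheafData.equivOfIsAffine.right_inv _
    rw [← hK]
    have : J.comap f ≤ K := by
      rw [← Scheme.IdealSheafData.le_map_iff_comap_le]
      apply Scheme.IdealSheafData.le_of_isAffine
      rw [Scheme.IdealSheafData.ideal_map K f ⟨⊤, isAffineOpen_top _⟩ (isAffineOpen_top _)]
      rw [← Ideal.map_le_iff_le_comap]
      exact hK.ge
    exact this _
  · rw [Ideal.map_le_iff_le_comap]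
    have := (Scheme.IdealSheafData.le_map_comap J f) ⟨⊤, isAffineOpen_top _⟩
    rwa [Scheme.IdealSheafData.ideal_map _ f ⟨⊤, isAffineOpen_top _⟩ (isAffineOpen_top _)] at this

lemma idealOn_comap {A : CommRingCat.{u}} {X Y : Scheme.{u}} (f : Spec A ⟶ X) (g : X ⟶ Y)
    (J : Y.IdealSheafData) : idealOn f (J.comap g) = idealOn (f ≫ g) J := by
  simp [idealOn]

lemma idealOn_SpecMap_comp {A B : CommRingCat.{u}} {X : Scheme.{u}} (φ : A ⟶ B) (f : Spec A ⟶ X)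
    (J : X.IdealSheafData) : idealOn (Spec.map φ ≫ f) J = (idealOn f J).map φ.hom := by
  simp only [idealOn, Scheme.IdealSheafData.comap_comp]
  rw [comap_ideal_top, Ideal.map_map, Ideal.map_map, ← CommRingCat.hom_comp, ← CommRingCat.hom_comp,
    Scheme.ΓSpecIso_naturality]

lemma idealOn_of_isOpenImmersion {A : CommRingCat.{u}} {X : Scheme.{u}} (f : Spec A ⟶ X)
    [IsOpenImmersion f] (J : X.IdealSheafData) :
    idealOn f J = (J.ideal ⟨f ''ᵁ ⊤, (isAffineOpen_top _).image_of_isOpenImmersion f⟩).map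
      ((f.appIso ⊤).hom ≫ (Scheme.ΓSpecIso A).hom).hom := by
  rw [idealOn, Scheme.IdealSheafData.ideal_comap_of_isOpenImmersion, CommRingCat.hom_comp,
    ← Ideal.map_map]
  congr 1
  exact (Ideal.map_symm (f.appIso ⊤).symm.commRingCatIsoToRingEquiv).symm

lemma idealOn_mul_of_isOpenImmersion {A : CommRingCat.{u}} {X : Scheme.{u}} (f : Spec A ⟶ X)
    [IsOpenImmersion f] (I J : X.IdealSheafData) :
    idealOn f (I * J) = idealOn f I * idealOn f J := by
  simp [idealOn_of_isOpenImmersion, Ideal.map_mul]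

lemma idealOn_fromSpec {X : Scheme.{u}} {U : X.Opens} (hU : IsAffineOpen U)
    (J : X.IdealSheafData) : idealOn hU.fromSpec J = J.ideal ⟨U, hU⟩ := by
  rw [idealOn_of_isOpenImmersion]
  have hle : hU.fromSpec ''ᵁ ⊤ ≤ U := by
    rw [Scheme.Hom.image_top_eq_opensRange, hU.opensRange_fromSpec]
  rw [← J.map_ideal (U := ⟨_, (isAffineOpen_top _).image_of_isOpenImmersion _⟩) (V := ⟨U, hU⟩) hle,
    Ideal.map_map, ← CommRingCat.hom_comp]
  convert Ideal.map_id _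
  change _ = (𝟙 Γ(X, U) : Γ(X, U) ⟶ Γ(X, U)).hom
  congr 1
  rw [Scheme.Hom.appIso_hom', Scheme.Hom.map_appLE_assoc]
  rw [Scheme.Hom.appLE, hU.fromSpec_app_self]
  simp [← Functor.map_comp]

lemma ideal_comap_appLE {X Y : Scheme.{u}} (f : X ⟶ Y) (J : Y.IdealSheafData) {U : X.Opens}
    (hU : IsAffineOpen U) {V : Y.Opens} (hV : IsAffineOpen V) (h : U ≤ f ⁻¹ᵁ V) :
    (J.comap f).ideal ⟨U, hU⟩ = (J.ideal ⟨V, hV⟩).map (f.appLE V U h).hom := by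
  rw [← idealOn_fromSpec, ← idealOn_fromSpec, idealOn_comap, ← hV.SpecMap_appLE_fromSpec f hU h,
    idealOn_SpecMap_comp]

lemma exists_affineOpens_le_preimage {X Y : Scheme.{u}} (f : X ⟶ Y) (x : X) {V : Y.Opens}
    (hV : f x ∈ V) : ∃ U : X.Opens, IsAffineOpen U ∧ x ∈ U ∧ U ≤ f ⁻¹ᵁ V := by
  obtain ⟨_, ⟨U, hU, rfl⟩, hxU, hUV⟩ :=
    X.isBasis_affineOpens.exists_subset_of_mem_open (u := f ⁻¹ᵁ V) hV (f ⁻¹ᵁ V).2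
  exact ⟨U, hU, hxU, hUV⟩

lemma exists_affineOpens {X : Scheme.{u}} (x : X) {V : X.Opens}
    (hV : x ∈ V) : ∃ U : X.Opens, IsAffineOpen U ∧ x ∈ U ∧ U ≤ V :=
  exists_affineOpens_le_preimage (𝟙 X) x hV

lemma idealSheafData_ext_of_forall_exists {X : Scheme.{u}} {I J : X.IdealSheafData}
    (h : ∀ x : X, ∃ U : X.affineOpens, x ∈ U.1 ∧ I.ideal U = J.ideal U) : I = J := by
  choose U hxU hU using h
  refine Scheme.IdealSheafData.ext_of_iSup_eq_top U ?_ hU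
  rw [eq_top_iff]
  intro x _
  exact TopologicalSpace.Opens.mem_iSup.mpr ⟨x, hxU x⟩

lemma comap_mul {X Y : Scheme.{u}} (f : X ⟶ Y) (I J : Y.IdealSheafData) :
    (I * J).comap f = I.comap f * J.comap f := by
  refine idealSheafData_ext_of_forall_exists fun x ↦ ?_
  obtain ⟨V, hV, hxV, -⟩ := exists_affineOpens (f x) (V := ⊤) trivial
  obtain ⟨U, hU, hxU, hUV⟩ := exists_affineOpens_le_preimage f x hxV
  refine ⟨⟨U, hU⟩, hxU, ?_⟩
  simp [ideal_comap_appLE f _ hU hV hUV, Ideal.map_mul]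

lemma comap_pow {X Y : Scheme.{u}} (f : X ⟶ Y) (I : Y.IdealSheafData) (n : ℕ) :
    (I ^ n).comap f = I.comap f ^ n := by
  induction n with
  | zero => simp
  | succ n ih => rw [pow_succ, comap_mul, ih, pow_succ]

/-- Two affine neighbourhoods contain a common smaller one, from which both generate the same ideal,
so the supremum is constant. -/
lemma stalkIdeal_eq {X : Scheme.{u}} (J : X.IdealSheafData) {x : X} {U : X.Opens}
    (hU : IsAffineOpen U) (hx : x ∈ U) :
    stalkIdeal J x = (J.ideal ⟨U, hU⟩).map (X.presheaf.germ U x hx).hom := by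
  apply le_antisymm
  · refine iSup₂_le fun V hxV ↦ ?_
    obtain ⟨D, hD, hxD, hDle⟩ := exists_affineOpens x (V := U ⊓ V.1) ⟨hx, hxV⟩
    have key (V' : X.affineOpens) (hxV' : x ∈ V'.1) (hle : D ≤ V'.1) :
        (J.ideal V').map (X.presheaf.germ V'.1 x hxV').hom =
          (J.ideal ⟨D, hD⟩).map (X.presheaf.germ D x hxD).hom := by
      rw [← J.map_ideal (U := ⟨D, hD⟩) (V := V') hle, Ideal.map_map, ← CommRingCat.hom_comp]
      simp
    rw [key V hxV (hDle.trans inf_le_right), key ⟨U, hU⟩ hx (hDle.trans inf_le_left)]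
  · exact le_iSup₂_of_le (f := fun (U : X.affineOpens) (hx : x ∈ U.1) ↦
      (J.ideal U).map (X.presheaf.germ U.1 x hx).hom) ⟨U, hU⟩ hx le_rfl

lemma stalkIdeal_comap {X Y : Scheme.{u}} (f : X ⟶ Y) (J : Y.IdealSheafData) (x : X) :
    stalkIdeal (J.comap f) x = (stalkIdeal J (f x)).map (f.stalkMap x).hom := by
  obtain ⟨V, hV, hxV, -⟩ := exists_affineOpens (f x) (V := ⊤) trivial
  obtain ⟨U, hU, hxU, hUV⟩ := exists_affineOpens_le_preimage f x hxV
  rw [stalkIdeal_eq _ hU hxU, stalkIdeal_eq _ hV hxV, ideal_comap_appLE f _ hU hV hUV,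
    Ideal.map_map, Ideal.map_map, ← CommRingCat.hom_comp, ← CommRingCat.hom_comp]
  simp [Scheme.Hom.germ_stalkMap, Scheme.Hom.appLE]

lemma le_ordAt_iff {X : Scheme.{u}} (J : X.IdealSheafData) (x : X) (n : ℕ) :
    n ≤ ordAt J x ↔
      stalkIdeal J x ≤ IsLocalRing.maximalIdeal (X.presheaf.stalk x) ^ n := by
  constructor
  · intro h
    by_contra hn
    have : ordAt J x ≤ ((n - 1 : ℕ) : ℕ∞) := by
      refine iSup₂_le fun m hm ↦ ?_
      rw [Nat.cast_le]
      by_contra! hlt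
      exact hn (hm.trans (Ideal.pow_le_pow_right (by omega)))
    have h2 := h.trans this
    rw [Nat.cast_le] at h2
    -- Subtraction is truncated, so `n ≤ n - 1` leaves the case `n = 0`, where the zeroth power is
    -- the unit ideal.
    obtain rfl : n = 0 := by omega
    simp at hn
  · intro h
    exact le_iSup₂_of_le (f := fun (n : ℕ) (_ : stalkIdeal J x ≤
      IsLocalRing.maximalIdeal (X.presheaf.stalk x) ^ n) ↦ (n : ℕ∞)) n h le_rfl

lemma ordAt_le_iff {X : Scheme.{u}} (J : X.IdealSheafData) (x : X) (n : ℕ) :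
    ordAt J x ≤ n ↔ ¬ ((n + 1 : ℕ) : ℕ∞) ≤ ordAt J x := by
  rw [not_le, Nat.cast_add, Nat.cast_one, ENat.lt_add_one_iff (by simp)]

lemma map_maximalIdeal_le {A B : Type*} [CommRing A] [CommRing B] [IsLocalRing A] [IsLocalRing B]
    (f : A →+* B) [IsLocalHom f] :
    (IsLocalRing.maximalIdeal A).map f ≤ IsLocalRing.maximalIdeal B :=
  Ideal.map_le_iff_le_comap.mpr fun a ha hu ↦ ha (isUnit_of_map_unit f a (by simpa using hu))

lemma mem_maximalIdeal_pow_of_bijective {A B : Type*} [CommRing A] [CommRing B] [IsLocalRing A]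
    [IsLocalRing B] (f : A →+* B) (hf : Function.Bijective f) {n : ℕ} {a : A}
    (ha : f a ∈ IsLocalRing.maximalIdeal B ^ n) : a ∈ IsLocalRing.maximalIdeal A ^ n := by
  let e := RingEquiv.ofBijective f hf
  have h2 := Ideal.mem_map_of_mem (e.symm : B →+* A) ha
  rw [Ideal.map_pow] at h2
  have h3 := Ideal.pow_right_mono (map_maximalIdeal_le (e.symm : B →+* A)) n h2
  have h4 : (e.symm : B →+* A) (f a) = a := e.symm_apply_apply a
  rwa [h4] at h3

/-- Stalk maps are local, so orders can only grow under pullback; this suffices to bound orders on a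
blow-up by orders on charts. -/
lemma ordAt_le_ordAt_comap {X Y : Scheme.{u}} (f : X ⟶ Y) (J : Y.IdealSheafData) (x : X) :
    ordAt J (f x) ≤ ordAt (J.comap f) x := by
  refine ENat.forall_natCast_le_iff_le.mp fun n hn ↦ ?_
  rw [le_ordAt_iff] at hn ⊢
  rw [stalkIdeal_comap]
  refine (Ideal.map_mono hn).trans ?_
  rw [Ideal.map_pow]
  exact Ideal.pow_right_mono (map_maximalIdeal_le (f.stalkMap x).hom) n

lemma ordAt_comap_of_isOpenImmersion {X Y : Scheme.{u}} (f : X ⟶ Y) [IsOpenImmersion f]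
    (J : Y.IdealSheafData) (x : X) :
    ordAt (J.comap f) x = ordAt J (f x) := by
  refine le_antisymm ?_ (ordAt_le_ordAt_comap f J x)
  refine ENat.forall_natCast_le_iff_le.mp fun n hn ↦ ?_
  rw [le_ordAt_iff] at hn ⊢
  rw [stalkIdeal_comap, Ideal.map_le_iff_le_comap] at hn
  exact hn.trans fun a ha ↦ mem_maximalIdeal_pow_of_bijective (f.stalkMap x).hom
    (ConcreteCategory.bijective_of_isIso (f.stalkMap x)) ha

lemma map_le_maximalIdeal_pow_iff {A L : Type*} [CommRing A] [CommRing L] [Algebra A L]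
    [IsLocalRing L] (p : Ideal A) [p.IsPrime] [IsLocalization.AtPrime L p] (J : Ideal A) (n : ℕ) :
    J.map (algebraMap A L) ≤ IsLocalRing.maximalIdeal L ^ n ↔
      ∀ f ∈ J, ∃ s ∉ p, s * f ∈ p ^ n := by
  rw [Ideal.map_le_iff_le_comap, ← IsLocalization.AtPrime.map_eq_maximalIdeal p L, ← Ideal.map_pow]
  refine forall₂_congr fun f _ ↦ ?_
  rw [Ideal.mem_comap, IsLocalization.algebraMap_mem_map_algebraMap_iff p.primeCompl]
  rfl

/-- The multiplier `s` expresses membership in the symbolic power of the prime, so that orders can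
be handled without localizing. -/
lemma le_ordAt_Spec_iff {A : CommRingCat.{u}} (J : (Spec A).IdealSheafData) (p : Spec A) (n : ℕ) :
    n ≤ ordAt J p ↔ ∀ f ∈ idealOn (𝟙 _) J, ∃ s ∉ p.asIdeal, s * f ∈ p.asIdeal ^ n := by
  have : p.asIdeal.IsPrime := PrimeSpectrum.isPrime p
  let : Algebra A ((Spec A).presheaf.stalk p) := StructureSheaf.stalkAlgebra A p
  have : IsLocalization.AtPrime ((Spec A).presheaf.stalk p) p.asIdeal :=
    StructureSheaf.IsLocalization.to_stalk A p
  rw [le_ordAt_iff, ← map_le_maximalIdeal_pow_iff (L := (Spec A).presheaf.stalk p) p.asIdeal,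
    stalkIdeal_eq J (isAffineOpen_top _) trivial, idealOn, Scheme.IdealSheafData.comap_id,
    Ideal.map_map]
  have : (algebraMap A ((Spec A).presheaf.stalk p)).comp (Scheme.ΓSpecIso A).hom.hom =
      ((Spec A).presheaf.germ ⊤ p trivial).hom := by
    have : (Scheme.ΓSpecIso A).hom ≫ CommRingCat.ofHom (algebraMap A ((Spec A).presheaf.stalk p)) =
      (Spec A).presheaf.germ ⊤ p trivial := by
      rw [← Iso.eq_inv_comp]
      rfl
    rw [← this]
    rfl
  rw [this]

end SimpleCouples
end

/-! ### Dehomogenization, and the order of a polynomial of bounded degree. -/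

noncomputable section
namespace SimpleCouples
open MvPolynomial

lemma degree_eq_of_mem_support {ι D : Type*} [CommRing D] {F : MvPolynomial ι D} {n : ℕ} (hF : F.IsHomogeneous n)
    {α : ι →₀ ℕ} (hα : α ∈ F.support) : α.degree = n := by
  rw [← hF (mem_support_iff.mp hα), Finsupp.degree_eq_weight_one]
  rfl

section Dehomogenize
variable {ι : Type*} [DecidableEq ι] (i : ι) {D : Type*} [CommRing D]

/-- Setting the variable `X i` equal to `1`. -/
def dehomogenize : MvPolynomial ι D →ₐ[D] MvPolynomial {j // j ≠ i} D :=
  aeval fun j ↦ if h : j = i then 1 else X ⟨j, h⟩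

lemma dehomogenize_monomial (α : ι →₀ ℕ) (c : D) :
    dehomogenize i (monomial α c) = monomial (α.subtypeDomain (· ≠ i)) c := by
  have h1 : dehomogenize i (monomial α (1 : D)) = monomial (α.subtypeDomain (· ≠ i)) 1 := by
    induction α using Finsupp.induction_linear with
    | zero => simp
    | add f g hf hg =>
      rw [← mul_one (1 : D), ← monomial_mul, map_mul, hf, hg, monomial_mul,
        Finsupp.subtypeDomain_add]
    | single j n =>
      rw [← X_pow_eq_monomial, map_pow, dehomogenize, aeval_X]
      split_ifs with h
      · subst h
        have : (Finsupp.single j n).subtypeDomain (· ≠ j) = 0 := by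
          ext ⟨k, hk⟩
          simp [hk.symm]
        simp [this]
      · have : (Finsupp.single j n).subtypeDomain (· ≠ i) = Finsupp.single ⟨j, h⟩ n := by
          ext ⟨k, hk⟩
          simp [Finsupp.single_apply]
        rw [X_pow_eq_monomial, this]
  rw [← mul_one c, ← smul_eq_mul, ← smul_monomial, map_smul, h1, smul_monomial]

lemma dehomogenize_eq_sum (F : MvPolynomial ι D) :
    dehomogenize i F = ∑ α ∈ F.support, monomial (α.subtypeDomain (· ≠ i)) (F.coeff α) := by
  conv_lhs => rw [F.as_sum, map_sum]
  simp [dehomogenize_monomial]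

lemma degree_eq_add_degree_subtypeDomain (α : ι →₀ ℕ) :
    α.degree = α i + (α.subtypeDomain (· ≠ i)).degree := by
  induction α using Finsupp.induction_linear with
  | zero => simp
  | add f g hf hg => simp only [map_add, Finsupp.subtypeDomain_add, Finsupp.add_apply, hf, hg]; ring
  | single j n =>
    by_cases h : j = i
    · subst h
      have : (Finsupp.single j n).subtypeDomain (· ≠ j) = 0 := by
        ext ⟨k, hk⟩
        simp [hk.symm]
      simp [this]
    · have : (Finsupp.single j n).subtypeDomain (· ≠ i) = Finsupp.single ⟨j, h⟩ n := by
        ext ⟨k, hk⟩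
        simp [Finsupp.single_apply]
      simp [this, h]

/-- In a form of known degree the exponent of `X i` is determined by the others, so distinct
monomials stay distinct and nothing cancels. -/
lemma eq_zero_of_dehomogenize_eq_zero {F : MvPolynomial ι D} {n : ℕ} (hF : F.IsHomogeneous n)
    (h : dehomogenize i F = 0) : F = 0 := by
  ext α
  by_contra hα
  rw [coeff_zero] at hα
  have h2 := congr_arg (coeff (α.subtypeDomain (· ≠ i))) h
  rw [dehomogenize_eq_sum, coeff_sum, Finset.sum_eq_single α] at h2
  · simp at h2
    exact hα h2
  · intro β hβ hne
    rw [coeff_monomial, if_neg]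
    intro heq
    apply hne
    have h3 : β.degree = α.degree := by
      rw [degree_eq_of_mem_support hF hβ, degree_eq_of_mem_support hF (mem_support_iff.mpr hα)]
    rw [degree_eq_add_degree_subtypeDomain i, degree_eq_add_degree_subtypeDomain i α, heq] at h3
    ext j
    by_cases hj : j = i
    · subst hj; omega
    · exact DFunLike.congr_fun heq ⟨j, hj⟩
  · intro h; exact absurd (mem_support_iff.mpr hα) h

lemma totalDegree_dehomogenize_le {F : MvPolynomial ι D} {n : ℕ} (hF : F.IsHomogeneous n) :
    (dehomogenize i F).totalDegree ≤ n := by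
  rw [dehomogenize_eq_sum]
  refine totalDegree_finsetSum_le fun α hα ↦ (totalDegree_monomial_le _ _).trans ?_
  have := degree_eq_add_degree_subtypeDomain i α
  rw [degree_eq_of_mem_support hF hα] at this
  change (α.subtypeDomain (· ≠ i)).degree ≤ n
  omega

lemma map_dehomogenize {E : Type*} [CommRing E] (f : D →+* E) (F : MvPolynomial ι D) :
    map f (dehomogenize i F) = dehomogenize i (map f F) := by
  rw [dehomogenize_eq_sum, map_sum, F.as_sum, map_sum, map_sum]
  simp only [map_monomial, dehomogenize_monomial]
  rw [← F.as_sum]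

end Dehomogenize

lemma totalDegree_pderiv_le {σ D : Type*} [CommRing D] (G : MvPolynomial σ D) (j : σ) {n : ℕ} (hG : G.totalDegree ≤ n + 1) :
    (pderiv j G).totalDegree ≤ n := by
  refine Finset.sup_le fun α hα ↦ ?_
  rw [mem_support_iff, coeff_pderiv] at hα
  have h1 := (le_totalDegree (mem_support_iff.mpr (left_ne_zero_of_mul hα))).trans hG
  rw [Finsupp.sum_add_index' (by simp) (by simp), Finsupp.sum_single_index rfl] at h1
  omega

lemma derivation_mem_pow {D S : Type*} [CommRing D] [CommRing S] [Algebra D S] (δ : Derivation D S S)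
    (Q : Ideal S) (n : ℕ) {x : S} (hx : x ∈ Q ^ (n + 1)) : δ x ∈ Q ^ n := by
  induction n generalizing x with
  | zero => simp
  | succ n ih =>
    rw [pow_succ] at hx
    induction hx using Submodule.mul_induction_on' with
    | mem_mul_mem a ha b hb =>
      rw [Derivation.leibniz, smul_eq_mul, smul_eq_mul, mul_comm b, pow_succ]
      exact add_mem (Ideal.mul_mem_right _ _ (by rwa [← pow_succ]))
        (Ideal.mul_mem_mul (ih ha) hb)
    | add a _ b _ ha hb => rw [map_add]; exact add_mem ha hb

section Derivative
variable {σ : Type*} {D : Type*} [CommRing D] [IsDomain D] [CharZero D]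

/-- Characteristic zero enters here: the exponent brought down by differentiation is not zero in
`D`. -/
lemma exists_pderiv_ne_zero {G : MvPolynomial σ D} (hG : G.totalDegree ≠ 0) :
    ∃ j, pderiv j G ≠ 0 := by
  by_contra! h
  apply hG
  rw [totalDegree_eq_zero_iff]
  intro α hα j
  by_contra hj
  have h1 := congr_arg (coeff (α - Finsupp.single j 1)) (h j)
  have h2 : Finsupp.single j 1 ≤ α := by simpa [Nat.one_le_iff_ne_zero] using hj
  rw [coeff_zero, coeff_pderiv, tsub_add_cancel_of_le h2] at h1
  rcases mul_eq_zero.mp h1 with h3 | h3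
  · exact mem_support_iff.mp hα h3
  · exact Nat.cast_add_one_ne_zero _ h3

/-- A nonzero polynomial of degree at most `n` has order at most `n` at each prime lying over
zero. -/
lemma notMem_pow_of_totalDegree_le (Q : Ideal (MvPolynomial σ D)) [Q.IsPrime]
    (hQ : ∀ c, C c ∈ Q → c = 0) {n : ℕ} {G s : MvPolynomial σ D} (hG : G ≠ 0)
    (hdeg : G.totalDegree ≤ n) (hs : s ∉ Q) : s * G ∉ Q ^ (n + 1) := by
  induction n generalizing G s with
  | zero =>
    intro hmem
    obtain ⟨c, rfl⟩ : ∃ c, G = C c := ⟨_, totalDegree_eq_zero_iff_eq_C.mp (by omega)⟩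
    have h2 := (Ideal.IsPrime.mem_or_mem ‹_› (by simpa using hmem)).resolve_left hs
    exact hG (by rw [hQ c h2, map_zero])
  | succ n ih =>
    intro hmem
    by_cases h0 : G.totalDegree = 0
    · exact ih hG (by omega) hs (Ideal.pow_le_pow_right (by omega) hmem)
    · obtain ⟨j, hj⟩ := exists_pderiv_ne_zero h0
      -- Differentiating `s * G` also produces `pderiv j s * G`; multiplying once more by `s` turns
      -- this into a multiple of `s * G`, whence the multiplier `s * s`.
      refine ih hj (totalDegree_pderiv_le G j hdeg) (s := s * s)
        (fun h ↦ (Ideal.IsPrime.mem_or_mem ‹_› h).elim hs hs) ?_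
      have h1 : pderiv j (s * G) ∈ Q ^ (n + 1) := derivation_mem_pow _ Q _ hmem
      have h2 : s * s * pderiv j G = s * pderiv j (s * G) - pderiv j s * (s * G) := by
        rw [Derivation.leibniz, smul_eq_mul, smul_eq_mul]; ring
      rw [h2]
      exact sub_mem (Ideal.mul_mem_left _ _ h1)
        (Ideal.mul_mem_left _ _ (Ideal.pow_le_pow_right (by omega) hmem))

end Derivative
end SimpleCouples
end

/-! ### Charts of a blow-up in algebraic form, and the order bound on them. -/

noncomputable section
namespace SimpleCouples
open MvPolynomial

/-- `R` is the ring of the `i`-th chart of the blow-up of `Spec A` along the ideal generated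
by the family `x`; the `t j` are the quotients `x j / x i`. -/
structure IsBlowupChart {ι : Type} {A R : Type u} [CommRing A] [CommRing R] [Algebra A R]
    (x : ι → A) (i : ι) (t : ι → R) : Prop where
  self_eq_one : t i = 1
  algebraMap_eq : ∀ j, algebraMap A R (x j) = t j * algebraMap A R (x i)
  mem_nonZeroDivisors : algebraMap A R (x i) ∈ nonZeroDivisors R
  adjoin_eq_top : Algebra.adjoin A (Set.range t) = ⊤
  exists_lift : ∀ {S : Type u} [CommRing S] (φ : A →+* S) (s : ι → S), s i = 1 →
    (∀ j, φ (x j) = s j * φ (x i)) →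
    ∃ ψ : R →+* S, ψ.comp (algebraMap A R) = φ ∧ ∀ j, ψ (t j) = s j

lemma eval_monomial_mem_pow {ι A : Type*} [CommRing A] {x : ι → A} {K : Ideal A}
    (hx : ∀ j, x j ∈ K) (α : ι →₀ ℕ) : eval x (monomial α 1) ∈ K ^ α.degree := by
  induction α using Finsupp.induction_linear with
  | zero => simp
  | add f g hf hg =>
    rw [← mul_one (1 : A), ← monomial_mul, map_mul, map_add, pow_add]
    exact Ideal.mul_mem_mul hf hg
  | single j n =>
    rw [← X_pow_eq_monomial, map_pow, eval_X, Finsupp.degree_single]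
    exact Ideal.pow_mem_pow (hx j) n

lemma eval_mem_pow_of_isHomogeneous {ι A : Type*} [CommRing A] {x : ι → A} {K : Ideal A}
    (hx : ∀ j, x j ∈ K) {F : MvPolynomial ι A} {n : ℕ} (hF : F.IsHomogeneous n)
    (hK : map (Ideal.Quotient.mk K) F = 0) : eval x F ∈ K ^ (n + 1) := by
  rw [F.as_sum, map_sum]
  refine sum_mem fun α hα ↦ ?_
  rw [← mul_one (coeff α F), ← smul_eq_mul, ← smul_monomial, smul_eval, pow_succ']
  refine Ideal.mul_mem_mul ?_ (degree_eq_of_mem_support hF hα ▸ eval_monomial_mem_pow hx α)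
  have := congr_arg (coeff α) hK
  rwa [coeff_map, coeff_zero, Ideal.Quotient.eq_zero_iff_mem] at this

lemma aeval_mul_of_isHomogeneous {ι A R : Type*} [CommRing A] [CommRing R] [Algebra A R]
    (t : ι → R) (u : R) {F : MvPolynomial ι A} {n : ℕ} (hF : F.IsHomogeneous n) :
    aeval (fun j ↦ t j * u) F = u ^ n * aeval t F := by
  have key (α : ι →₀ ℕ) : aeval (fun j ↦ t j * u) (monomial α (1 : A)) =
      u ^ α.degree * aeval t (monomial α (1 : A)) := by
    induction α using Finsupp.induction_linear with
    | zero => simp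
    | add f g hf hg =>
      rw [← mul_one (1 : A), ← monomial_mul, map_mul, map_mul, map_add, pow_add, hf, hg]
      ring
    | single j n =>
      rw [← X_pow_eq_monomial, map_pow, map_pow, aeval_X, aeval_X, Finsupp.degree_single]
      ring
  rw [F.as_sum, map_sum, map_sum, Finset.mul_sum]
  refine Finset.sum_congr rfl fun α hα ↦ ?_
  rw [← mul_one (coeff α F), ← smul_eq_mul, ← smul_monomial, map_smul, map_smul, key,
    degree_eq_of_mem_support hF hα, mul_smul_comm]

namespace IsBlowupChart
variable {ι : Type} {A R : Type u} [CommRing A] [CommRing R] [Algebra A R]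
    {x : ι → A} {i : ι} {t : ι → R} (h : IsBlowupChart x i t)
include h

lemma exists_aeval_eq (r : R) : ∃ F : MvPolynomial ι A, aeval t F = r := by
  have : r ∈ Algebra.adjoin A (Set.range t) := h.adjoin_eq_top ▸ trivial
  rwa [Algebra.adjoin_range_eq_range_aeval] at this

lemma hom_ext {S : Type*} [CommRing S] {ψ ψ' : R →+* S}
    (h₁ : ψ.comp (algebraMap A R) = ψ'.comp (algebraMap A R)) (h₂ : ∀ j, ψ (t j) = ψ' (t j)) :
    ψ = ψ' := by
  ext r
  obtain ⟨F, rfl⟩ := h.exists_aeval_eq r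
  induction F using MvPolynomial.induction_on with
  | C a => simpa using DFunLike.congr_fun h₁ a
  | add p q hp hq => simp [hp, hq]
  | mul_X p j hp => simp [hp, h₂]

lemma algebraMap_eval {F : MvPolynomial ι A} {n : ℕ} (hF : F.IsHomogeneous n) :
    algebraMap A R (eval x F) = algebraMap A R (x i) ^ n * aeval t F := by
  rw [← aeval_mul_of_isHomogeneous t _ hF]
  simp_rw [← h.algebraMap_eq]
  have := aeval_algebraMap_apply R x F
  simpa [coe_aeval_eq_eval, Function.comp_def] using this.symm

variable [DecidableEq ι]

/-- `exists_lift` does not ask that `x i` stay a nonzerodivisor, so all `x j` may be sent to zero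
and the `t j`, `j ≠ i`, to free variables. This plays the role of the regularity of the sequence
`x`. -/
lemma exists_specialization (K : Ideal A) (hK : ∀ j, x j ∈ K) :
    ∃ ψ : R →+* MvPolynomial {j // j ≠ i} (A ⧸ K),
      ψ.comp (algebraMap A R) = C.comp (Ideal.Quotient.mk K) ∧
      ∀ F, ψ (aeval t F) = dehomogenize i (map (Ideal.Quotient.mk K) F) := by
  obtain ⟨ψ, h1, h2⟩ := h.exists_lift (C.comp (Ideal.Quotient.mk K))
    (fun j ↦ if h : j = i then (1 : MvPolynomial {j // j ≠ i} (A ⧸ K)) else X ⟨j, h⟩) (by simp)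
    (fun j ↦ by simp [Ideal.Quotient.eq_zero_iff_mem.mpr (hK _)])
  refine ⟨ψ, h1, fun F ↦ ?_⟩
  induction F using MvPolynomial.induction_on with
  | C a => simpa [dehomogenize] using DFunLike.congr_fun h1 a
  | add p q hp hq => simp [hp, hq]
  | mul_X p j hp =>
    rw [map_mul, map_mul, hp, map_mul, map_mul, aeval_X, h2, map_X]
    simp [dehomogenize]

/-- This bounds the kernel of the specialization modulo `K`: as `t i = 1`, the value at `t` depends
only on the dehomogenization, whose coefficients lie in `K`. -/
lemma aeval_mem_map {K : Ideal A} {F : MvPolynomial ι A}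
    (hF : dehomogenize i (map (Ideal.Quotient.mk K) F) = 0) :
    aeval t F ∈ K.map (algebraMap A R) := by
  have h1 : aeval t F = aeval (fun j : {j // j ≠ i} ↦ t j) (dehomogenize i F) := by
    rw [dehomogenize, ← AlgHom.comp_apply, comp_aeval]
    congr 2
    ext j
    split_ifs with hj
    · simp [hj, h.self_eq_one]
    · simp
  rw [← map_dehomogenize] at hF
  rw [h1, (dehomogenize i F).as_sum, map_sum]
  refine sum_mem fun α _ ↦ ?_
  rw [aeval_monomial]
  refine Ideal.mul_mem_right _ _ (Ideal.mem_map_of_mem _ ?_)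
  have := congr_arg (coeff α) hF
  rwa [coeff_map, coeff_zero, Ideal.Quotient.eq_zero_iff_mem] at this

/-- Climb one power at a time: if `f = F(x)` with `F` of degree `c < b`, then `F(t)` is still
divisible by `x i`, so it specializes to zero, and the coefficients of `F` lie in the ideal. -/
lemma mem_span_pow {f : A} {b : ℕ} {g : R}
    (hf : algebraMap A R f = algebraMap A R (x i) ^ b * g) :
    f ∈ Ideal.span (Set.range x) ^ b := by
  suffices ∀ c ≤ b, f ∈ Ideal.span (Set.range x) ^ c from this b le_rfl
  intro c
  induction c with
  | zero => simp
  | succ c ih =>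
    intro hc
    obtain ⟨F, hF, rfl⟩ := (Ideal.mem_span_pow_iff_exists_isHomogeneous x f).mp (ih (by omega))
    have hx (j) : x j ∈ Ideal.span (Set.range x) := Ideal.subset_span ⟨j, rfl⟩
    refine eval_mem_pow_of_isHomogeneous hx hF ?_
    obtain ⟨d, rfl⟩ : ∃ d, b = c + (d + 1) := ⟨b - c - 1, by omega⟩
    rw [h.algebraMap_eval hF, pow_add, mul_assoc] at hf
    have h1 := (mul_cancel_left_mem_nonZeroDivisors (pow_mem h.mem_nonZeroDivisors c)).mp hf
    obtain ⟨ψ, hψ, hψ'⟩ := h.exists_specialization _ hx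
    refine eq_zero_of_dehomogenize_eq_zero i (hF.map _) ?_
    have h2 : ψ (algebraMap A R (x i)) = 0 := by
      refine (DFunLike.congr_fun hψ (x i)).trans ?_
      simp [Ideal.Quotient.eq_zero_iff_mem.mpr (hx i)]
    rw [← hψ', h1, map_mul, map_pow, h2, zero_pow (by omega), zero_mul]

/-- The order of the transform of `J` at a point `z` of the chart is at most `b`, if `J` has
order at most `b` at the image `p` of `z`, and `p` contains the centre. -/
theorem exists_notMem_pow {p : Ideal A} [p.IsPrime] [CharZero (A ⧸ p)] (hp : ∀ j, x j ∈ p)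
    {z : Ideal R} [z.IsPrime] (hz : z.comap (algebraMap A R) = p) {J : Ideal A} {J₁ : Ideal R}
    {b : ℕ} (hJ : J.map (algebraMap A R) = Ideal.span {algebraMap A R (x i)} ^ b * J₁)
    {f : A} (hfJ : f ∈ J) (hf : f ∉ p ^ (b + 1)) :
    ∃ g ∈ J₁, ∀ s ∉ z, s * g ∉ z ^ (b + 1) := by
  have h1 := Ideal.mem_map_of_mem (algebraMap A R) hfJ
  rw [hJ, Ideal.span_singleton_pow, Ideal.mem_span_singleton_mul] at h1
  obtain ⟨g, hg, hfg⟩ := h1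
  obtain ⟨F, hF, rfl⟩ :=
    (Ideal.mem_span_pow_iff_exists_isHomogeneous x f).mp (h.mem_span_pow hfg.symm)
  have hg' : g = aeval t F := by
    rw [h.algebraMap_eval hF] at hfg
    exact (mul_cancel_left_mem_nonZeroDivisors (pow_mem h.mem_nonZeroDivisors b)).mp hfg
  refine ⟨g, hg, fun s hs hsg ↦ ?_⟩
  -- The reduction is modulo the point `p`, not merely modulo the centre: `z` then corresponds to a
  -- prime lying over zero in `A ⧸ p`.
  obtain ⟨ψ, hψ, hψ'⟩ := h.exists_specialization p hp
  have hker : RingHom.ker ψ ≤ z := by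
    intro r hr
    obtain ⟨G, rfl⟩ := h.exists_aeval_eq r
    rw [RingHom.mem_ker, hψ'] at hr
    exact Ideal.map_le_iff_le_comap.mpr hz.ge (h.aeval_mem_map hr)
  have hsurj : Function.Surjective ψ := by
    intro q
    induction q using MvPolynomial.induction_on with
    | C a =>
      obtain ⟨a, rfl⟩ := Ideal.Quotient.mk_surjective a
      exact ⟨algebraMap A R a, DFunLike.congr_fun hψ a⟩
    | add p q hp hq =>
      obtain ⟨a, rfl⟩ := hp
      obtain ⟨b, rfl⟩ := hq
      exact ⟨a + b, map_add _ _ _⟩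
    | mul_X p j hp =>
      obtain ⟨a, rfl⟩ := hp
      refine ⟨a * aeval t (X j.1 : MvPolynomial ι A), ?_⟩
      rw [map_mul, hψ', MvPolynomial.map_X]
      simp [dehomogenize, j.2]
  have hQ : (z.map ψ).IsPrime := Ideal.map_isPrime_of_surjective hsurj hker
  have hcomap : (z.map ψ).comap ψ = z := by
    rw [Ideal.comap_map_of_surjective _ hsurj]
    exact sup_eq_left.mpr hker
  have hmem (r : R) : ψ r ∈ z.map ψ ↔ r ∈ z := by rw [← Ideal.mem_comap, hcomap]
  refine notMem_pow_of_totalDegree_le (z.map ψ) (fun c hc ↦ ?_) (n := b) (G := ψ g) (s := ψ s)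
    (fun h0 ↦ ?_) ?_ ((hmem s).not.mpr hs) ?_
  · obtain ⟨a, rfl⟩ := Ideal.Quotient.mk_surjective c
    rw [Ideal.Quotient.eq_zero_iff_mem, ← hz, Ideal.mem_comap, ← hmem]
    have h2 : ψ (algebraMap A R a) = C (Ideal.Quotient.mk p a) := DFunLike.congr_fun hψ a
    rwa [h2]
  · rw [hg', hψ'] at h0
    exact hf (eval_mem_pow_of_isHomogeneous hp hF (eq_zero_of_dehomogenize_eq_zero i (hF.map _) h0))
  · rw [hg', hψ']
    exact totalDegree_dehomogenize_le i (hF.map _)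
  · rw [← map_mul, ← Ideal.map_pow]
    exact Ideal.mem_map_of_mem ψ hsg

lemma nontrivial_of_isPrime {p : Ideal A} [p.IsPrime] (hp : ∀ j, x j ∈ p) : Nontrivial R := by
  obtain ⟨ψ, -, -⟩ := h.exists_specialization p hp
  exact ψ.domain_nontrivial

end IsBlowupChart
end SimpleCouples
end

/-! ### Construction of smooth charts by base change from affine space. -/

noncomputable section
namespace SimpleCouples
open MvPolynomial TensorProduct

section Construction

/-- `B` is a copy of the polynomial ring, an algebra over the original through the monoidal
substitution: the chart of affine space. The chart over `A` is `B ⊗ A`; smoothness of `A` over the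
polynomial ring gives flatness, which keeps `x i` a nonzerodivisor, and smoothness over `B`. -/
theorem exists_isBlowupChart_of_algEquiv {k A B : Type u} [Field k] [CommRing A] [Algebra k A]
    {ι : Type} [DecidableEq ι] [Algebra (MvPolynomial ι k) A] [IsScalarTower k (MvPolynomial ι k) A]
    [Algebra.Smooth (MvPolynomial ι k) A]
    [CommRing B] [Algebra k B] [Algebra (MvPolynomial ι k) B]
    [IsScalarTower k (MvPolynomial ι k) B] (e : MvPolynomial ι k ≃ₐ[k] B) (i : ι)
    (he : algebraMap (MvPolynomial ι k) B (X i) = e (X i))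
    (he' : ∀ j ≠ i, algebraMap (MvPolynomial ι k) B (X j) = e (X j) * e (X i)) [Finite ι] :
    ∃ (R : Type u) (_ : CommRing R) (_ : Algebra A R) (t : ι → R),
      IsBlowupChart (fun j ↦ algebraMap (MvPolynomial ι k) A (X j)) i t ∧
      ((algebraMap A R).comp (algebraMap k A)).Smooth := by
  let inc : A →ₐ[MvPolynomial ι k] (B ⊗[MvPolynomial ι k] A) := Algebra.TensorProduct.includeRight
  let : Algebra A (B ⊗[MvPolynomial ι k] A) := inc.toRingHom.toAlgebra
  have hA (a : A) :
      algebraMap A (B ⊗[MvPolynomial ι k] A) a = (1 : B) ⊗ₜ[MvPolynomial ι k] a := rfl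
  have hP (q : MvPolynomial ι k) : algebraMap A (B ⊗[MvPolynomial ι k] A) (algebraMap (MvPolynomial ι k) A q) =
      algebraMap (MvPolynomial ι k) B q ⊗ₜ[MvPolynomial ι k] (1 : A) :=
    (Algebra.TensorProduct.tmul_one_eq_one_tmul q).symm
  have hk (c : k) : algebraMap A (B ⊗[MvPolynomial ι k] A) (algebraMap k A c) =
      algebraMap k B c ⊗ₜ[MvPolynomial ι k] (1 : A) := by
    rw [IsScalarTower.algebraMap_apply k (MvPolynomial ι k) A, hP,
      ← IsScalarTower.algebraMap_apply k (MvPolynomial ι k) B]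
  let t (j : ι) : (B ⊗[MvPolynomial ι k] A) :=
    if j = i then 1 else e (X j) ⊗ₜ[MvPolynomial ι k] (1 : A)
  refine ⟨B ⊗[MvPolynomial ι k] A, inferInstance, inferInstance, t,
    ⟨by simp [t], fun j ↦ ?_, ?_, ?_, ?_⟩, ?_⟩
  · by_cases hj : j = i
    · simp [hj, t]
    · rw [hP, hP, he' j hj, he]
      simp [t, if_neg hj]
  · rw [hP, he]
    have h1 : e (X i) ∈ nonZeroDivisors B := by
      have : IsDomain B := e.symm.toMulEquiv.isDomain _
      simp [X_ne_zero]
    have h2 : IsSMulRegular (B ⊗[MvPolynomial ι k] A) (e (X i)) :=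
      Module.Flat.isSMulRegular_of_nonZeroDivisors h1
    rw [mem_nonZeroDivisors_iff_right]
    intro r hr
    refine h2.right_eq_zero_of_smul ?_
    rwa [Algebra.smul_def, mul_comm]
  · rw [eq_top_iff]
    rintro r -
    induction r using TensorProduct.induction_on with
    | zero => exact zero_mem _
    | add x y hx hy => exact add_mem hx hy
    | tmul b a =>
      have : b ⊗ₜ[MvPolynomial ι k] a =
          (b ⊗ₜ[MvPolynomial ι k] (1 : A) : (B ⊗[MvPolynomial ι k] A)) *
            algebraMap A (B ⊗[MvPolynomial ι k] A) a := by simp [hA]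
      rw [this]
      refine mul_mem ?_ (Subalgebra.algebraMap_mem _ _)
      obtain ⟨q, rfl⟩ := e.surjective b
      induction q using MvPolynomial.induction_on with
      | C c =>
        rw [← algebraMap_eq, AlgEquiv.commutes, ← hk]
        exact Subalgebra.algebraMap_mem _ _
      | add p q hp hq =>
        rw [map_add, TensorProduct.add_tmul]
        exact add_mem (hp (by simp [hA])) (hq (by simp [hA]))
      | mul_X p j hp =>
        rw [map_mul, ← mul_one (1 : A), ← Algebra.TensorProduct.tmul_mul_tmul]
        refine mul_mem (hp (by simp [hA])) ?_
        by_cases hj : j = i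
        · rw [hj, ← he, ← hP]
          exact Subalgebra.algebraMap_mem _ _
        · exact Algebra.subset_adjoin ⟨j, by simp [t, hj]⟩
  · intro S _ φ s hsi hs
    let : Algebra (MvPolynomial ι k) S := (φ.comp (algebraMap (MvPolynomial ι k) A)).toAlgebra
    -- In `B` the variable `i` is the exceptional parameter itself, while the others are the
    -- quotients `t j`.
    let θ₀ : B →+* S := (eval₂Hom (φ.comp (algebraMap k A))
      (fun j ↦ if j = i then φ (algebraMap (MvPolynomial ι k) A (X i)) else s j)).comp (e.symm : B →+* _)
    have hθ (q : MvPolynomial ι k) : θ₀ (e q) = eval₂Hom (φ.comp (algebraMap k A))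
      (fun j ↦ if j = i then φ (algebraMap (MvPolynomial ι k) A (X i)) else s j) q := by
      simp [θ₀]
    let θ : B →ₐ[MvPolynomial ι k] S :=
      { θ₀ with
        commutes' := by
          intro q
          change (θ₀.comp (algebraMap (MvPolynomial ι k) B)) q =
            (φ.comp (algebraMap (MvPolynomial ι k) A)) q
          congr 1
          refine MvPolynomial.ringHom_ext (fun c ↦ ?_) (fun j ↦ ?_)
          · have h1 := IsScalarTower.algebraMap_apply k (MvPolynomial ι k) B c
            have h2 := IsScalarTower.algebraMap_apply k (MvPolynomial ι k) A c
            rw [← e.commutes, algebraMap_eq] at h1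
            rw [algebraMap_eq] at h2
            change θ₀ (algebraMap _ B (C c)) = φ (algebraMap _ A (C c))
            rw [← h1, ← h2, hθ]
            simp
          · by_cases hj : j = i
            · rw [hj, RingHom.comp_apply, he, hθ]
              simp
            · rw [RingHom.comp_apply, he' j hj, map_mul, hθ, hθ, RingHom.comp_apply, hs j]
              simp [hj] }
    let φ' : A →ₐ[MvPolynomial ι k] S := { φ with commutes' := fun q ↦ rfl }
    let Ψ := Algebra.TensorProduct.lift θ φ' (fun _ _ ↦ Commute.all _ _)
    refine ⟨Ψ.toRingHom, ?_, fun j ↦ ?_⟩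
    · ext a
      change Ψ (1 ⊗ₜ a) = φ a
      simp [Ψ, φ']
    · change Ψ (t j) = _
      by_cases hj : j = i
      · simp [t, hj, hsi]
      · simp only [t, if_neg hj, Ψ, Algebra.TensorProduct.lift_tmul]
        change θ₀ (e (X j)) * φ 1 = _
        rw [hθ]
        simp [hj]
  · have h1 : (algebraMap A (B ⊗[MvPolynomial ι k] A)).comp (algebraMap k A) =
        (algebraMap B (B ⊗[MvPolynomial ι k] A)).comp (algebraMap k B) := RingHom.ext hk
    have : Algebra.Smooth k (MvPolynomial ι k) := ⟨inferInstance, inferInstance⟩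
    have : Algebra.Smooth k B := .of_equiv e
    rw [h1]
    exact (RingHom.smooth_algebraMap.mpr this).comp (RingHom.smooth_algebraMap.mpr inferInstance)

/-- The substitution `X j ↦ X j * X i` for `j ≠ i`. -/
def monoidalSubstitution (k : Type u) [Field k] {ι : Type} [DecidableEq ι] (i : ι) :
    MvPolynomial ι k →ₐ[k] MvPolynomial ι k :=
  aeval fun j ↦ if j = i then X i else X j * X i

theorem exists_isBlowupChart {k A : Type u} [Field k] [CommRing A] [Algebra k A]
    {ι : Type} [DecidableEq ι] [Finite ι] (x : ι → A) (i : ι)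
    (hx : (aeval (R := k) x).toRingHom.Smooth) :
    ∃ (R : Type u) (_ : CommRing R) (_ : Algebra A R) (t : ι → R), IsBlowupChart x i t ∧
      ((algebraMap A R).comp (algebraMap k A)).Smooth := by
  let : Algebra (MvPolynomial ι k) A := (aeval (R := k) x).toRingHom.toAlgebra
  have : IsScalarTower k (MvPolynomial ι k) A :=
    .of_algebraMap_eq' (aeval (R := k) x).comp_algebraMap.symm
  have : Algebra.Smooth (MvPolynomial ι k) A := hx
  have h := @exists_isBlowupChart_of_algEquiv k A (MvPolynomial ι k) _ _ _ ι _ _ _ _ _ _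
    (monoidalSubstitution k i).toRingHom.toAlgebra
    (@IsScalarTower.mk _ _ _ _ (monoidalSubstitution k i).toRingHom.toAlgebra.toSMul _ fun a b c ↦ by
      change monoidalSubstitution k i (a • b) * c = a • (monoidalSubstitution k i b * c)
      simp) AlgEquiv.refl i
    (by change monoidalSubstitution k i (X i) = X i; simp [monoidalSubstitution])
    (fun j hj ↦ by
      change monoidalSubstitution k i (X j) = X j * X i
      simp [monoidalSubstitution, hj]) _
  convert! h with R _ _ t j
  exact (aeval_X x j).symm

end Construction
end SimpleCouples
end

/-! ### Coordinates adapted to a smooth centre; smooth algebras are reduced. -/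

noncomputable section
namespace SimpleCouples
open MvPolynomial TensorProduct

section Coordinates

lemma injective_of_linearIndependent_comp_basis {K V W ι : Type*} [Field K] [AddCommGroup V]
    [Module K V] [AddCommGroup W] [Module K W] (b : Module.Basis ι K V) (f : V →ₗ[K] W)
    (h : LinearIndependent K (f ∘ b)) : Function.Injective f := by
  rw [injective_iff_map_eq_zero]
  intro v hv
  have h1 : Finsupp.linearCombination K (f ∘ b) (b.repr v) = 0 := by
    rw [← Finsupp.apply_linearCombination, b.linearCombination_repr, hv]
  simpa using (linearIndependent_iff.mp h) _ h1

/-- If `P → L` induces a split injection on differentials relative to `k`, then `L` is formally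
smooth over `P` as soon as it is formally smooth over `k`. -/
lemma formallySmooth_of_split_mapBaseChange (k P L : Type*) [CommRing k] [CommRing P] [CommRing L]
    [Algebra k P] [Algebra k L] [Algebra P L] [IsScalarTower k P L] [Algebra.FormallySmooth k L]
    (h : ∃ l, l ∘ₗ KaehlerDifferential.mapBaseChange k P L = LinearMap.id) :
    Algebra.FormallySmooth P L := by
  have hinj : Function.Injective (KaehlerDifferential.mapBaseChange k P L) := by
    obtain ⟨l, hl⟩ := h
    exact Function.HasLeftInverse.injective ⟨l, LinearMap.congr_fun hl⟩
  rw [Algebra.formallySmooth_iff]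
  constructor
  · obtain ⟨s, hs⟩ := (((KaehlerDifferential.exact_mapBaseChange_map k P L).split_tfae hinj
      (KaehlerDifferential.map_surjective k P L)).out 0 1).mpr h
    exact Module.Projective.of_split s _ hs
  -- In the Jacobi–Zariski sequence injectivity kills the boundary map, so every class comes from
  -- the first cotangent homology of `L` over `k`, which vanishes.
  · refine subsingleton_of_forall_eq 0 fun y ↦ ?_
    have h1 : Algebra.H1Cotangent.δ k P L y = 0 := hinj (by
      rw [map_zero]
      exact (Algebra.H1Cotangent.exact_δ_mapBaseChange k P L _).mpr ⟨y, rfl⟩)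
    obtain ⟨w, rfl⟩ := (Algebra.H1Cotangent.exact_map_δ k P L y).mp h1
    rw [Subsingleton.elim w 0, map_zero]

/-- A minimal system of generators of an ideal with formally smooth quotient is part of
a system of coordinates. -/
lemma formallySmooth_of_linearIndependent {k L : Type u} {ι : Type*} [Field k] [CommRing L] [Algebra k L]
    [IsLocalRing L] [Algebra.FormallySmooth k L] [Module.Free L Ω[L⁄k]] [Module.Finite L Ω[L⁄k]]
    [Finite ι] (K : Ideal L) [Algebra.FormallySmooth k (L ⧸ K)]
    (hK : K ≤ IsLocalRing.maximalIdeal L) (x : ι → K)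
    (hx : LinearIndependent (IsLocalRing.ResidueField L)
      fun j ↦ (1 : IsLocalRing.ResidueField L) ⊗ₜ[L] x j)
    [Algebra (MvPolynomial ι k) L] [IsScalarTower k (MvPolynomial ι k) L]
    (hL : ∀ j, algebraMap (MvPolynomial ι k) L (X j) = x j) :
    Algebra.FormallySmooth (MvPolynomial ι k) L := by
  apply formallySmooth_of_split_mapBaseChange k
  rw [IsLocalRing.split_injective_iff_lTensor_residueField_injective]
  let κ := IsLocalRing.ResidueField L
  obtain ⟨l, hl⟩ := (Algebra.FormallySmooth.iff_split_injection (R := k) (P := L) (A := L ⧸ K)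
    Ideal.Quotient.mk_surjective).mp inferInstance
  have hker : RingHom.ker (algebraMap L (L ⧸ K)) = K := Ideal.mk_ker
  let ν₀ : RingHom.ker (algebraMap L (L ⧸ K)) →ₗ[L] κ ⊗[L] K :=
    TensorProduct.mk L κ K 1 ∘ₗ (LinearEquiv.ofEq _ _ hker).toLinearMap
  have hν₀ (y z) : ν₀ (y * z) = 0 := by
    have h1 : y * z = (y : L) • z := rfl
    have h2 : IsLocalRing.residue L y = 0 := by
      rw [IsLocalRing.residue_eq_zero_iff]
      exact hK (hker.le y.2)
    have h3 (m : κ ⊗[L] K) : (y : L) • m = 0 := by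
      rw [← algebraMap_smul κ (y : L) m]
      exact (congr_arg (· • m) h2).trans (zero_smul κ m)
    rw [h1, map_smul, h3]
  let ν := Ideal.Cotangent.lift ν₀ hν₀
  -- A retraction of the conormal sequence of `L ⧸ K` gives a map sending `dy` to the class of `y`
  -- for `y ∈ K`; independence of the `x j` in `κ ⊗ K` therefore forces independence of their
  -- differentials.
  let Λ : Ω[L⁄k] →ₗ[L] κ ⊗[L] K := ν ∘ₗ l ∘ₗ TensorProduct.mk L (L ⧸ K) Ω[L⁄k] 1
  have hΛ (y : K) : Λ (KaehlerDifferential.D k L y) = 1 ⊗ₜ y := by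
    have h1 := LinearMap.congr_fun hl (Ideal.toCotangent _ ⟨y, hker.ge y.2⟩)
    rw [LinearMap.comp_apply, KaehlerDifferential.kerCotangentToTensor_toCotangent] at h1
    change ν (l (1 ⊗ₜ KaehlerDifferential.D k L y)) = _
    rw [h1, LinearMap.id_apply, Ideal.Cotangent.lift_toCotangent]
    rfl
  let b := ((KaehlerDifferential.mvPolynomialBasis k ι).baseChange L).baseChange κ
  let f : κ ⊗[L] (L ⊗[MvPolynomial ι k] Ω[MvPolynomial ι k⁄k]) →ₗ[κ] κ ⊗[L] K :=
    Λ.liftBaseChange κ ∘ₗ (KaehlerDifferential.mapBaseChange k (MvPolynomial ι k) L).baseChange κ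
  have hf : Function.Injective f := by
    apply injective_of_linearIndependent_comp_basis b
    have h1 : f ∘ b = fun j ↦ (1 : κ) ⊗ₜ[L] x j := by
      funext j
      simp [f, b, hL, hΛ]
    rw [h1]
    exact hx
  exact Function.Injective.of_comp hf

/-- An ideal of a local ring which is generated by a family of elements has a minimal system of
generators in this family. -/
lemma exists_minimal_generators {L : Type u} [CommRing L] [IsLocalRing L] {K : Ideal L}
    (hK : K.FG) {α : Type u} (v : α → K) (hv : Submodule.span L (Set.range v) = ⊤) :
    ∃ (n : ℕ) (a : Fin n → α), Submodule.span L (Set.range (v ∘ a)) = ⊤ ∧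
      LinearIndependent (IsLocalRing.ResidueField L)
      fun j ↦ (1 : IsLocalRing.ResidueField L) ⊗ₜ[L] v (a j) := by
  let κ := IsLocalRing.ResidueField L
  have : Module.Finite L K := .of_fg hK
  have h1 : Submodule.span κ (Set.range fun i ↦ (1 : κ) ⊗ₜ[L] v i) = ⊤ := by
    have h2 := (IsLocalRing.map_tensorProduct_mk_eq_top (N := Submodule.span L (Set.range v))).mpr hv
    rw [← Submodule.span_image, ← Set.range_comp, eq_top_iff, ← SetLike.coe_subset_coe,
      Submodule.top_coe] at h2
    rw [eq_top_iff]
    exact Set.Subset.trans h2 (Submodule.span_subset_span _ _ _)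
  obtain ⟨ι, a, -, hspan, hli⟩ := exists_linearIndependent' κ
    (fun i ↦ (1 : κ) ⊗ₜ[L] v i : α → κ ⊗[L] K)
  have : Finite ι := hli.finite
  obtain ⟨n, ⟨e⟩⟩ := Finite.exists_equiv_fin ι
  rw [h1] at hspan
  refine ⟨n, a ∘ e.symm, ?_, hli.comp _ e.symm.injective⟩
  have h3 : Submodule.span L (Set.range (v ∘ a)) = ⊤ :=
    IsLocalRing.span_eq_top_of_tmul_eq_basis _ (.mk hli hspan.ge) fun _ ↦ by simp
  rwa [← Function.comp_assoc, e.symm.surjective.range_comp]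

/-- Around a point of a smooth subscheme of a smooth scheme over a field, the subscheme is cut out
by part of a system of coordinates. -/
lemma exists_smooth_coordinates {k A : Type u} [Field k] [CommRing A] [Algebra k A]
    [Algebra.Smooth k A] (I : Ideal A) [Algebra.Smooth k (A ⧸ I)] (p : Ideal A) [p.IsPrime]
    (hI : I ≤ p) :
    ∃ h ∉ p, ∃ (r : ℕ) (x : Fin r → A), (∀ j, x j ∈ I) ∧
      ∀ (B : Type u) [CommRing B] [Algebra A B] [IsLocalization.Away h B],
        I.map (algebraMap A B) = Ideal.span (Set.range (algebraMap A B ∘ x)) ∧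
        ((algebraMap A B).comp (aeval (R := k) x).toRingHom).Smooth := by
  have : IsNoetherianRing A := Algebra.FiniteType.isNoetherianRing k A
  let L := Localization.AtPrime p
  have : Algebra.FormallySmooth k L := inferInstance
  let K := I.map (algebraMap A L)
  have hK : K ≤ IsLocalRing.maximalIdeal L := by
    rw [← Localization.AtPrime.map_eq_maximalIdeal]
    exact Ideal.map_mono hI
  have : Algebra.FormallySmooth k (L ⧸ K) := by
    have h1 : IsLocalization (Algebra.algebraMapSubmonoid (A ⧸ I) p.primeCompl) (L ⧸ K) :=
      inferInstance
    have : Algebra.FormallySmooth (A ⧸ I) (L ⧸ K) :=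
      .of_isLocalization (Algebra.algebraMapSubmonoid (A ⧸ I) p.primeCompl)
    have : IsScalarTower k (A ⧸ I) (L ⧸ K) := by
      refine .of_algebraMap_eq' ?_
      rfl
    exact .comp k (A ⧸ I) (L ⧸ K)
  have : Module.Free L Ω[L⁄k] := Module.free_of_flat_of_isLocalRing
  -- Generators are sought among images of elements of `I`, so that the minimal ones lift to `A`.
  have hv : Submodule.span L (Set.range fun y : I ↦
      (⟨algebraMap A L y, Ideal.mem_map_of_mem _ y.2⟩ : K)) = ⊤ := by
    refine Submodule.map_injective_of_injective K.injective_subtype ?_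
    rw [Submodule.map_span, Submodule.map_top, Submodule.range_subtype, ← Set.range_comp]
    change Ideal.span _ = Ideal.span _
    congr 1
    ext y
    simp
  obtain ⟨r, a, hspan, hli⟩ := exists_minimal_generators
    ((isNoetherianRing_iff_ideal_fg L).mp inferInstance K) _ hv
  let x : Fin r → A := fun j ↦ a j
  let : Algebra (MvPolynomial (Fin r) k) A := (aeval (R := k) x).toRingHom.toAlgebra
  have hxA : algebraMap (MvPolynomial (Fin r) k) A = (aeval (R := k) x).toRingHom := rfl
  have : IsScalarTower k (MvPolynomial (Fin r) k) A :=
    .of_algebraMap_eq' ((aeval (R := k) x).comp_algebraMap).symm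
  have hsm : Algebra.FormallySmooth (MvPolynomial (Fin r) k) L := by
    refine formallySmooth_of_linearIndependent (k := k) K hK _ hli fun j ↦ ?_
    rw [IsScalarTower.algebraMap_apply _ A L, hxA]
    simp [x]
  have : Algebra.IsSmoothAt (MvPolynomial (Fin r) k) p := hsm
  have : Algebra.FiniteType (MvPolynomial (Fin r) k) A := .of_restrictScalars_finiteType k _ _
  have : Algebra.FinitePresentation (MvPolynomial (Fin r) k) A :=
    Algebra.FinitePresentation.of_finiteType.mp inferInstance
  obtain ⟨f, hfp, hf⟩ := Algebra.IsSmoothAt.exists_notMem_smooth (MvPolynomial (Fin r) k) p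
  have hxI : Ideal.span (Set.range x) ≤ I := by
    rw [Ideal.span_le]
    rintro _ ⟨j, rfl⟩
    exact (a j).2
  have hmap : K = (Ideal.span (Set.range x)).map (algebraMap A L) := by
    have h1 := congr_arg (Submodule.map K.subtype) hspan
    rw [Submodule.map_span, Submodule.map_top, Submodule.range_subtype, ← Set.range_comp] at h1
    rw [Ideal.map_span, ← Set.range_comp]
    exact h1.symm
  have hloc (y : A) (hy : y ∈ I) : ∃ s ∉ p, s * y ∈ Ideal.span (Set.range x) := by
    have h1 : algebraMap A L y ∈ K := Ideal.mem_map_of_mem _ hy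
    rwa [hmap, IsLocalization.algebraMap_mem_map_algebraMap_iff p.primeCompl] at h1
  -- `I` is finitely generated, so one common denominator makes the `x j` generate it away from `g`;
  -- `f` secures smoothness.
  obtain ⟨g, hgp, hg⟩ : ∃ g ∉ p, ∀ y ∈ I, g * y ∈ Ideal.span (Set.range x) := by
    classical
    obtain ⟨S, hS⟩ := (isNoetherianRing_iff_ideal_fg A).mp inferInstance I
    choose! s hsp hs using hloc
    refine ⟨∏ y ∈ S, s y, fun h1 ↦ ?_, fun y hy ↦ ?_⟩
    · obtain ⟨y, hy, hy'⟩ := (Ideal.IsPrime.prod_mem_iff).mp h1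
      exact hsp y (hS ▸ Ideal.subset_span hy) hy'
    · rw [← hS] at hy
      refine Submodule.span_induction (p := fun y _ ↦ (∏ y ∈ S, s y) * y ∈
        Ideal.span (Set.range x)) (fun y hy ↦ ?_) (by simp) (fun y z _ _ hy hz ↦ ?_)
        (fun a y _ hy ↦ ?_) hy
      · rw [← Finset.mul_prod_erase S s hy, mul_right_comm]
        exact Ideal.mul_mem_right _ _ (hs y (hS ▸ Ideal.subset_span hy))
      · rw [mul_add]
        exact add_mem hy hz
      · rw [smul_eq_mul, mul_left_comm]
        exact Ideal.mul_mem_left _ _ hy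
  refine ⟨f * g, fun h1 ↦ ?_, r, x, fun j ↦ (a j).2, fun B _ _ hB ↦ ⟨?_, ?_⟩⟩
  · exact (Ideal.IsPrime.mem_or_mem ‹_› h1).elim hfp hgp
  · have hfg : IsUnit (algebraMap A B (f * g)) := IsLocalization.Away.algebraMap_isUnit _
    rw [map_mul] at hfg
    rw [Set.range_comp, ← Ideal.map_span]
    refine le_antisymm (Ideal.map_le_iff_le_comap.mpr fun y hy ↦ ?_) (Ideal.map_mono hxI)
    rw [Ideal.mem_comap, ← Ideal.unit_mul_mem_iff_mem _ (isUnit_of_mul_isUnit_right hfg), ← map_mul]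
    exact Ideal.mem_map_of_mem _ (hg y hy)
  · have h1 : Algebra.Smooth (MvPolynomial (Fin r) k) (Localization.Away (f * g)) := by
      rw [← Algebra.basicOpen_subset_smoothLocus_iff_smooth] at hf ⊢
      exact Set.Subset.trans (PrimeSpectrum.basicOpen_mul_le_left f g) hf
    let e : Localization.Away (f * g) ≃ₐ[A] B := IsLocalization.algEquiv (.powers (f * g)) _ _
    have h2 : (algebraMap (MvPolynomial (Fin r) k) (Localization.Away (f * g))).Smooth :=
      RingHom.smooth_algebraMap.mpr h1
    have h3 : (algebraMap A B).comp (aeval (R := k) x).toRingHom =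
        (e.toRingEquiv : _ →+* B).comp
          (algebraMap (MvPolynomial (Fin r) k) (Localization.Away (f * g))) := by
      rw [IsScalarTower.algebraMap_eq _ A (Localization.Away (f * g)), ← RingHom.comp_assoc, ← hxA]
      congr 1
      exact (e.toAlgHom.comp_algebraMap).symm
    rw [h3]
    exact RingHom.Smooth.respectsIso.1 _ e.toRingEquiv h2

/-- Flatness embeds `A` in its base change to the fraction field of `P`, which is unramified over a
field. -/
lemma isReduced_of_etale (P A : Type*) [CommRing P] [IsDomain P] [CommRing A] [Algebra P A]
    [Algebra.Etale P A] : IsReduced A := by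
  let F := FractionRing P
  have : Algebra.FormallyUnramified F (F ⊗[P] A) := inferInstance
  have : IsReduced (F ⊗[P] A) := Algebra.FormallyUnramified.isReduced_of_field F _
  exact isReduced_of_injective (Algebra.TensorProduct.includeRight (R := P) (A := F) (B := A))
    (Algebra.TensorProduct.includeRight_injective (IsFractionRing.injective P F))

/-- A smooth algebra over a field is reduced. -/
lemma isReduced_of_smooth (k A : Type*) [Field k] [CommRing A] [Algebra k A]
    [Algebra.Smooth k A] : IsReduced A := by
  refine ⟨fun x hx ↦ eq_zero_of_localization _ fun m _ ↦ ?_⟩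
  obtain ⟨f, hf, n, _, _, _⟩ :=
    Algebra.IsSmoothAt.exists_isStandardEtale_mvPolynomial (R := k) (p := m)
  have : IsReduced (Localization.Away f) := isReduced_of_etale (MvPolynomial (Fin n) k) _
  obtain ⟨⟨_, l, rfl⟩, hl⟩ := (IsLocalization.map_eq_zero_iff (.powers f)
    (Localization.Away f) x).mp (hx.map (algebraMap A (Localization.Away f))).eq_zero
  exact (IsLocalization.map_eq_zero_iff m.primeCompl _ x).mpr
    ⟨⟨f ^ l, fun h ↦ hf (Ideal.IsPrime.mem_of_pow_mem inferInstance _ h)⟩, hl⟩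

end Coordinates
end SimpleCouples
end

/-! ### Comparison of charts with the universal property of the blow-up. -/

noncomputable section
namespace SimpleCouples
open MvPolynomial

lemma IsInvertibleIdeal.exists_le_of_flat {X Y : Scheme.{u}} {I : Y.IdealSheafData}
    (hI : IsInvertibleIdeal I) (f : X ⟶ Y) [Flat f] (x : X) {V : X.Opens} (hx : x ∈ V) :
    ∃ (U : X.Opens) (hU : IsAffineOpen U), x ∈ U ∧ U ≤ V ∧
      ∃ c ∈ nonZeroDivisors Γ(X, U), (I.comap f).ideal ⟨U, hU⟩ = Ideal.span {c} := by
  obtain ⟨⟨V', hV'⟩, hxV', c, hc, hIc⟩ := hI (f x)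
  obtain ⟨U, hU, hxU, hle⟩ := exists_affineOpens x (V := V ⊓ f ⁻¹ᵁ V') ⟨hx, hxV'⟩
  have hUV' := hle.trans inf_le_right
  refine ⟨U, hU, hxU, hle.trans inf_le_left, (f.appLE V' U hUV').hom c, ?_, ?_⟩
  · have hflat : (f.appLE V' U hUV').hom.Flat := Flat.flat_appLE f hV' hU hUV'
    let := (f.appLE V' U hUV').hom.toAlgebra
    have : Module.Flat Γ(Y, V') Γ(X, U) := hflat
    have h2 : IsSMulRegular Γ(X, U) c := Module.Flat.isSMulRegular_of_nonZeroDivisors hc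
    rw [mem_nonZeroDivisors_iff_right]
    intro z hz
    refine h2 ?_
    change c • z = c • 0
    rw [smul_zero, Algebra.smul_def, mul_comm]
    exact hz
  · rw [ideal_comap_appLE f I hU hV' hUV', hIc, Ideal.map_span, Set.image_singleton]

lemma IsInvertibleIdeal.exists_le {X : Scheme.{u}} {I : X.IdealSheafData}
    (hI : IsInvertibleIdeal I) (x : X) {V : X.Opens} (hx : x ∈ V) :
    ∃ (U : X.Opens) (hU : IsAffineOpen U), x ∈ U ∧ U ≤ V ∧
      ∃ c ∈ nonZeroDivisors Γ(X, U), I.ideal ⟨U, hU⟩ = Ideal.span {c} := by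
  simpa using hI.exists_le_of_flat (𝟙 X) x hx

lemma IsInvertibleIdeal.comap {X Y : Scheme.{u}} {I : Y.IdealSheafData}
    (hI : IsInvertibleIdeal I) (f : X ⟶ Y) [Flat f] : IsInvertibleIdeal (I.comap f) := by
  intro x
  obtain ⟨U, hU, hxU, -, hc⟩ := hI.exists_le_of_flat f x (V := ⊤) trivial
  exact ⟨⟨U, hU⟩, hxU, hc⟩

lemma isInvertibleIdeal_top (X : Scheme.{u}) : IsInvertibleIdeal (⊤ : X.IdealSheafData) := by
  intro x
  obtain ⟨U, hU, hxU, -⟩ := exists_affineOpens x (V := ⊤) trivial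
  exact ⟨⟨U, hU⟩, hxU, 1, one_mem _, by simp⟩

/-- Local charts of a blow-up: if a morphism `g` to the base which makes the center invertible is
a monomorphism on morphisms with this property, then every partial section of `g` over an open
subscheme of the blow-up identifies this with an open subscheme of the source of `g`. -/
lemma IsBlowup.comp_lift_eq_and_isOpenImmersion {W₁ W Z U : Scheme.{u}} {π : W₁ ⟶ W}
    {I : W.IdealSheafData} (hπ : IsBlowup π I) {g : Z ⟶ W} (hg : IsInvertibleIdeal (I.comap g))
    (hmono : ∀ {T : Scheme.{u}} (a b : T ⟶ Z), a ≫ g = b ≫ g →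
      IsInvertibleIdeal (I.comap (a ≫ g)) → a = b)
    {g₁ : Z ⟶ W₁} (hg₁ : g₁ ≫ π = g) (j : U ⟶ W₁) [IsOpenImmersion j] (h : U ⟶ Z)
    (hj : h ≫ g = j ≫ π) : h ≫ g₁ = j ∧ IsOpenImmersion h := by
  have h1 : h ≫ g₁ = j := by
    have h2 : IsInvertibleIdeal (I.comap (j ≫ π)) := by
      rw [Scheme.IdealSheafData.comap_comp]
      exact hπ.invertible.comap j
    exact (hπ.existsUnique_lift _ h2).unique (by rw [Category.assoc, hg₁, hj]) rfl
  refine ⟨h1, ?_⟩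
  -- The fibre product is an open subscheme of `Z`. The monomorphism property makes its projection
  -- to `U` inverse to the section `s`, so `U` itself is open in `Z`.
  have h3 : Limits.pullback.fst g₁ j = Limits.pullback.snd g₁ j ≫ h := by
    apply hmono
    · rw [Category.assoc, hj, ← hg₁, Limits.pullback.condition_assoc]
    · rw [Scheme.IdealSheafData.comap_comp]
      exact hg.comap _
  let s : U ⟶ Limits.pullback g₁ j := Limits.pullback.lift h (𝟙 U) (by rw [h1, Category.id_comp])
  have hs1 : s ≫ Limits.pullback.fst g₁ j = h := Limits.pullback.lift_fst _ _ _
  have hs2 : s ≫ Limits.pullback.snd g₁ j = 𝟙 U := Limits.pullback.lift_snd _ _ _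
  have h4 : Limits.pullback.snd g₁ j ≫ s = 𝟙 _ := by
    apply Limits.pullback.hom_ext
    · rw [Category.assoc, hs1, Category.id_comp, h3]
    · rw [Category.assoc, hs2, Category.id_comp, Category.comp_id]
  have : IsIso s := ⟨Limits.pullback.snd g₁ j, hs2, h4⟩
  rw [← hs1]
  infer_instance

lemma Scheme.hom_ext_of_forall_fromSpec {X Y : Scheme.{u}} {f g : X ⟶ Y}
    (h : ∀ x : X, ∃ (U : X.Opens) (hU : IsAffineOpen U), x ∈ U ∧
      hU.fromSpec ≫ f = hU.fromSpec ≫ g) : f = g := by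
  choose U hU hxU hfg using h
  refine Scheme.Cover.hom_ext (Scheme.openCoverOfIsOpenCover X U ?_) _ _ fun x ↦ ?_
  · rw [TopologicalSpace.IsOpenCover, eq_top_iff]
    exact fun x _ ↦ TopologicalSpace.Opens.mem_iSup.mpr ⟨x, hxU x⟩
  · change (U x).ι ≫ f = (U x).ι ≫ g
    rw [← cancel_epi (hU x).isoSpec.inv]
    exact hfg x

section Chart
variable {ι : Type} {A R : Type u} [CommRing A] [CommRing R] [Algebra A R]
  {x : ι → A} {i : ι} {t : ι → R}

lemma IsBlowupChart.map_span (h : IsBlowupChart x i t) :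
    (Ideal.span (Set.range x)).map (algebraMap A R) = Ideal.span {algebraMap A R (x i)} := by
  rw [Ideal.map_span, ← Set.range_comp]
  apply le_antisymm
  · rw [Ideal.span_le]
    rintro _ ⟨j, rfl⟩
    exact Ideal.mem_span_singleton'.mpr ⟨t j, (h.algebraMap_eq j).symm⟩
  · rw [Ideal.span_singleton_le_iff_mem]
    exact Ideal.subset_span ⟨i, rfl⟩

/-- The `i`-th chart of the blow-up, as a scheme over the base. -/
abbrev chartMap (A R : Type u) [CommRing A] [CommRing R] [Algebra A R] {W : Scheme.{u}}
    (v : Spec (.of A) ⟶ W) : Spec (.of R) ⟶ W :=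
  Spec.map (CommRingCat.ofHom (algebraMap A R)) ≫ v

variable {W : Scheme.{u}} {v : Spec (.of A) ⟶ W} {I : W.IdealSheafData}

lemma IsBlowupChart.idealOn_chartMap (h : IsBlowupChart x i t)
    (hI : idealOn v I = Ideal.span (Set.range x)) :
    idealOn (chartMap A R v) I = Ideal.span {algebraMap A R (x i)} := by
  rw [idealOn_SpecMap_comp, hI]
  exact h.map_span

lemma IsBlowupChart.isInvertibleIdeal_comap (h : IsBlowupChart x i t)
    (hI : idealOn v I = Ideal.span (Set.range x)) :
    IsInvertibleIdeal (I.comap (chartMap A R v)) := by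
  have h1 := h.idealOn_chartMap hI
  let e := (Scheme.ΓSpecIso (.of R)).commRingCatIsoToRingEquiv
  intro z
  refine ⟨⟨⊤, isAffineOpen_top _⟩, trivial, e.symm (algebraMap A R (x i)), ?_, ?_⟩
  · exact (MulEquivClass.map_nonZeroDivisors e.symm).le
      (Submonoid.mem_map_of_mem _ h.mem_nonZeroDivisors)
  · rw [idealOn] at h1
    have h2 := congr_arg (Ideal.map e.symm.toRingHom) h1
    rw [Ideal.map_span, Set.image_singleton] at h2
    refine Eq.trans ?_ h2
    rw [Ideal.map_map]
    convert (Ideal.map_id _).symm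
    exact e.symm_toRingHom_comp_toRingHom

/-- Once `x i` becomes a nonzerodivisor, `x j = t j * x i` determines the `t j`, and these generate
`R` over `A`. -/
lemma IsBlowupChart.chartMap_hom_ext [Mono v] (h : IsBlowupChart x i t)
    (hI : idealOn v I = Ideal.span (Set.range x)) {T : Scheme.{u}} (a b : T ⟶ Spec (.of R))
    (hab : a ≫ chartMap A R v = b ≫ chartMap A R v)
    (hT : IsInvertibleIdeal (I.comap (a ≫ chartMap A R v))) : a = b := by
  refine Scheme.hom_ext_of_forall_fromSpec fun y ↦ ?_
  obtain ⟨⟨U, hU⟩, hyU, c, hc, hIc⟩ := hT y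
  have hU' : IsAffineOpen U := hU
  refine ⟨U, hU', hyU, ?_⟩
  obtain ⟨α, hα⟩ := Spec.map_surjective (hU.fromSpec ≫ a)
  obtain ⟨β, hβ⟩ := Spec.map_surjective (hU.fromSpec ≫ b)
  rw [← hα, ← hβ]
  congr 1
  have h1 : CommRingCat.ofHom (algebraMap A R) ≫ α = CommRingCat.ofHom (algebraMap A R) ≫ β := by
    apply Spec.map_injective
    rw [Spec.map_comp, Spec.map_comp, hα, hβ, ← cancel_mono v]
    simpa using congr_arg (hU.fromSpec ≫ ·) hab
  have h2 (y : A) : α (algebraMap A R y) = β (algebraMap A R y) := ConcreteCategory.congr_hom h1 y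
  have h3 : Ideal.span {c} = Ideal.span {α (algebraMap A R (x i))} := by
    rw [← hIc, ← idealOn_fromSpec hU', idealOn_comap, ← Category.assoc, ← hα, idealOn_SpecMap_comp,
      h.idealOn_chartMap hI, Ideal.map_span, Set.image_singleton]
  -- It divides the nonzerodivisor `c`.
  have h4 : α (algebraMap A R (x i)) ∈ nonZeroDivisors Γ(T, U) := by
    obtain ⟨d, hd⟩ := Ideal.mem_span_singleton'.mp (h3.le (Ideal.mem_span_singleton_self c))
    rw [← hd] at hc
    exact (mul_mem_nonZeroDivisors.mp hc).2
  ext1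
  refine h.hom_ext (RingHom.ext h2) fun j ↦ ?_
  refine (mul_cancel_right_mem_nonZeroDivisors h4).mp ?_
  change α (t j) * _ = β (t j) * _
  rw [← map_mul, h2 (x i), ← map_mul, ← h.algebraMap_eq, h2]

end Chart
end SimpleCouples
end

/-! ### Covering a blow-up by charts; adapted coordinates on schemes. -/

noncomputable section
namespace SimpleCouples
open MvPolynomial

/-- A blow-up is locally covered by its charts. -/
lemma IsBlowup.exists_lift_chartMap {W₁ W : Scheme.{u}} {π : W₁ ⟶ W} {I : W.IdealSheafData}
    (hπ : IsBlowup π I) {V : W.Opens} (hV : IsAffineOpen V) {ι : Type} [Finite ι]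
    {x : ι → Γ(W, V)} (hI : I.ideal ⟨V, hV⟩ = Ideal.span (Set.range x))
    {R : ι → Type u} [∀ i, CommRing (R i)] [∀ i, Algebra Γ(W, V) (R i)] {t : ∀ i, ι → R i}
    (ht : ∀ i, IsBlowupChart x i (t i)) (y : W₁) (hy : π y ∈ V) :
    ∃ (i : ι) (U : W₁.Opens) (hU : IsAffineOpen U) (h : Spec Γ(W₁, U) ⟶ Spec (.of (R i))),
      y ∈ U ∧ h ≫ chartMap Γ(W, V) (R i) hV.fromSpec = hU.fromSpec ≫ π := by
  obtain ⟨U, hU, hyU, hUV, c, hc, hIc⟩ := hπ.invertible.exists_le y (V := π ⁻¹ᵁ V) hy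
  have : Fintype ι := Fintype.ofFinite ι
  let φ := (π.appLE V U hUV).hom
  have h1 : Ideal.span {c} = Ideal.span (Set.range (φ ∘ x)) := by
    rw [← hIc, ideal_comap_appLE π I hU hV hUV, hI, Ideal.map_span, ← Set.range_comp]
  have h2 (j : ι) : ∃ b, b * c = φ (x j) :=
    Ideal.mem_span_singleton'.mp (h1.ge (Ideal.subset_span ⟨j, rfl⟩))
  choose b hb using h2
  obtain ⟨a, ha⟩ := (Ideal.mem_span_range_iff_exists_fun).mp (h1.le (Ideal.mem_span_singleton_self c))
  -- Cancelling the local generator `c` in `c = ∑ a j * x j`, with `x j = b j * c`, shows that some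
  -- `b i` is a unit at `y`; there `t j ↦ b j / b i` defines the map to the chart.
  have h3 : ∑ j, a j * b j = 1 := by
    refine (mul_cancel_right_mem_nonZeroDivisors hc).mp ?_
    rw [one_mul, Finset.sum_mul]
    refine Eq.trans (Finset.sum_congr rfl fun j _ ↦ ?_) ha
    rw [mul_assoc, hb]
    rfl
  obtain ⟨i, hi⟩ : ∃ i, y ∈ W₁.basicOpen (b i) := by
    by_contra! hcon
    have h4 (j : ι) : W₁.presheaf.germ U y hyU (b j) ∈
        IsLocalRing.maximalIdeal (W₁.presheaf.stalk y) := by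
      have := hcon j
      rwa [Scheme.mem_basicOpen _ _ _ hyU] at this
    have h5 := congr_arg (W₁.presheaf.germ U y hyU).hom h3
    rw [map_sum, map_one] at h5
    refine (Ideal.ne_top_iff_one _).mp (IsLocalRing.maximalIdeal.isMaximal
      (W₁.presheaf.stalk y)).ne_top (h5 ▸ sum_mem fun j _ ↦ ?_)
    rw [map_mul]
    exact Ideal.mul_mem_left _ _ (h4 j)
  let U' := W₁.basicOpen (b i)
  have hU' : IsAffineOpen U' := hU.basicOpen (b i)
  let ρ := (W₁.presheaf.map (homOfLE (W₁.basicOpen_le (b i))).op).hom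
  have hunit : IsUnit (ρ (b i)) := RingedSpace.isUnit_res_basicOpen _ (b i)
  obtain ⟨w, hw⟩ := hunit.exists_right_inv
  have hle : U' ≤ π ⁻¹ᵁ V := (W₁.basicOpen_le (b i)).trans hUV
  have hφ (z) : (π.appLE V U' hle).hom z = ρ (φ z) := by
    rw [← CommRingCat.comp_apply, Scheme.Hom.appLE_map]
  obtain ⟨ψ, hψ, -⟩ := (ht i).exists_lift (π.appLE V U' hle).hom (fun j ↦ ρ (b j) * w) hw (by
    intro j
    rw [hφ, hφ, ← hb j, ← hb i, map_mul, map_mul]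
    linear_combination - ρ (b j) * ρ c * hw)
  refine ⟨i, U', hU', Spec.map (CommRingCat.ofHom ψ), hi, ?_⟩
  rw [← hV.SpecMap_appLE_fromSpec π hU' hle, ← Spec.map_comp_assoc, ← CommRingCat.ofHom_comp, hψ]
  rfl

lemma fromSpec_mem_basicOpen_iff {W : Scheme.{u}} {V : W.Opens} (hV : IsAffineOpen V)
    (p : Spec Γ(W, V)) (f : Γ(W, V)) : hV.fromSpec p ∈ W.basicOpen f ↔ f ∉ p.asIdeal := by
  change p ∈ hV.fromSpec ⁻¹ᵁ W.basicOpen f ↔ _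
  rw [hV.fromSpec_preimage_basicOpen]
  exact Iff.rfl

lemma fromSpec_mem {W : Scheme.{u}} {V : W.Opens} (hV : IsAffineOpen V) (p : Spec Γ(W, V)) :
    hV.fromSpec p ∈ V := by
  have h : hV.fromSpec p ∈ hV.fromSpec.opensRange := ⟨p, rfl⟩
  rwa [hV.opensRange_fromSpec] at h

lemma fromSpec_mem_support_iff {W : Scheme.{u}} {V : W.Opens} (hV : IsAffineOpen V)
    (p : Spec Γ(W, V)) (I : W.IdealSheafData) :
    hV.fromSpec p ∈ I.support ↔ I.ideal ⟨V, hV⟩ ≤ p.asIdeal := by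
  rw [Scheme.IdealSheafData.mem_support_iff_of_mem (U := ⟨V, hV⟩) (fromSpec_mem hV p),
    Scheme.mem_zeroLocus_iff]
  simp [fromSpec_mem_basicOpen_iff, SetLike.le_def]

section Coordinates
variable {k : Type u} [Field k]

lemma exists_algebra_of_smooth {A : CommRingCat.{u}} (f : Spec A ⟶ Spec (.of k)) [Smooth f] :
    ∃ _ : Algebra k A, Spec.map (CommRingCat.ofHom (algebraMap k A)) = f ∧ Algebra.Smooth k A := by
  obtain ⟨φ, rfl⟩ := Spec.map_surjective f
  have h := (HasRingHomProperty.Spec_iff (P := @Smooth)).mp ‹_›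
  exact ⟨φ.hom.toAlgebra, rfl, h⟩

lemma smooth_quotient_ideal {W : Scheme.{u}} {str : W ⟶ Spec (.of k)} {I : W.IdealSheafData}
    [Smooth (I.subschemeι ≫ str)] (V : W.affineOpens) [Algebra k Γ(W, V.1)]
    (hstr : Spec.map (CommRingCat.ofHom (algebraMap k Γ(W, V.1))) = V.2.fromSpec ≫ str) :
    Algebra.Smooth k (Γ(W, V.1) ⧸ I.ideal V) := by
  let c : Spec (.of (Γ(W, V.1) ⧸ I.ideal V)) ⟶ I.subscheme := I.subschemeCover.f V
  have hc : IsOpenImmersion c := I.subschemeCover.map_prop V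
  have h1 : c ≫ I.subschemeι =
      Spec.map (CommRingCat.ofHom (Ideal.Quotient.mk (I.ideal V))) ≫ V.2.fromSpec :=
    (I.subschemeCover_map_subschemeι V).trans (I.glueDataObjι_ι V)
  have h2 : Smooth (Spec.map (CommRingCat.ofHom (algebraMap k (Γ(W, V.1) ⧸ I.ideal V)))) := by
    have h3 : Spec.map (CommRingCat.ofHom (algebraMap k (Γ(W, V.1) ⧸ I.ideal V))) =
        c ≫ I.subschemeι ≫ str := by
      rw [reassoc_of% h1, ← hstr, ← Spec.map_comp]
      rfl
    rw [h3]
    infer_instance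
  exact RingHom.smooth_algebraMap.mp ((HasRingHomProperty.Spec_iff (P := @Smooth)).mp h2)

/-- Around a point of a smooth subscheme of a smooth scheme over a field, the subscheme is cut out
by part of a system of coordinates. -/
lemma exists_affineOpens_smooth_coordinates {W : Scheme.{u}} (str : W ⟶ Spec (.of k)) [Smooth str]
    (I : W.IdealSheafData) [Smooth (I.subschemeι ≫ str)] {w : W} (hw : w ∈ I.support) :
    ∃ (V : W.Opens) (hV : IsAffineOpen V) (_ : Algebra k Γ(W, V)) (r : ℕ) (x : Fin r → Γ(W, V)),
      w ∈ V ∧ Spec.map (CommRingCat.ofHom (algebraMap k Γ(W, V))) = hV.fromSpec ≫ str ∧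
      Algebra.Smooth k Γ(W, V) ∧
      I.ideal ⟨V, hV⟩ = Ideal.span (Set.range x) ∧ (aeval (R := k) x).toRingHom.Smooth := by
  obtain ⟨V, hV, hwV, -⟩ := exists_affineOpens w (V := ⊤) trivial
  obtain ⟨_, hstr, _⟩ := exists_algebra_of_smooth (hV.fromSpec ≫ str)
  have hq : Algebra.Smooth k (Γ(W, V) ⧸ I.ideal ⟨V, hV⟩) := smooth_quotient_ideal ⟨V, hV⟩ hstr
  let p := hV.primeIdealOf ⟨w, hwV⟩
  have hpw : hV.fromSpec p = w := hV.fromSpec_primeIdealOf ⟨w, hwV⟩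
  have hp : I.ideal ⟨V, hV⟩ ≤ p.asIdeal := (fromSpec_mem_support_iff hV p I).mp (by rwa [hpw])
  have := p.2
  obtain ⟨h, hh, r, x, -, H⟩ := exists_smooth_coordinates (k := k) (I.ideal ⟨V, hV⟩) p.asIdeal hp
  let D := W.basicOpen h
  have hD : IsAffineOpen D := hV.basicOpen h
  have hle : D ≤ V := W.basicOpen_le h
  let ρ := W.presheaf.map (homOfLE hle).op
  let : Algebra Γ(W, V) Γ(W, D) := ρ.hom.toAlgebra
  have : IsLocalization.Away h Γ(W, D) := hV.isLocalization_basicOpen h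
  obtain ⟨H1, H2⟩ := H Γ(W, D)
  obtain ⟨inst, hstrD, hsm⟩ := exists_algebra_of_smooth (hD.fromSpec ≫ str)
  have halg : algebraMap k Γ(W, D) = ρ.hom.comp (algebraMap k Γ(W, V)) := by
    have h1 : CommRingCat.ofHom (algebraMap k Γ(W, D)) =
        CommRingCat.ofHom (algebraMap k Γ(W, V)) ≫ ρ := by
      apply Spec.map_injective
      rw [hstrD, Spec.map_comp, hstr, hV.map_fromSpec_assoc hD]
    exact congr_arg CommRingCat.Hom.hom h1
  refine ⟨D, hD, inst, r, ρ.hom ∘ x, hpw ▸ (fromSpec_mem_basicOpen_iff hV p h).mpr hh,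
    hstrD, hsm, ?_, ?_⟩
  · rw [← I.map_ideal (U := ⟨D, hD⟩) (V := ⟨V, hV⟩) hle]
    exact H1
  · convert H2
    refine MvPolynomial.ringHom_ext (fun c ↦ ?_) fun j ↦ ?_
    · simpa using! DFunLike.congr_fun halg c
    · simp [RingHom.algebraMap_toAlgebra]

end Coordinates

end SimpleCouples
end

/-! ### Smoothness, order and nonemptiness after one transformation. -/

noncomputable section
namespace SimpleCouples
open MvPolynomial

lemma idealOn_pow_of_isOpenImmersion {A : CommRingCat.{u}} {X : Scheme.{u}} (f : Spec A ⟶ X)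
    [IsOpenImmersion f] (I : X.IdealSheafData) (n : ℕ) : idealOn f (I ^ n) = idealOn f I ^ n := by
  induction n with
  | zero =>
    rw [pow_zero, pow_zero, idealOn_of_isOpenImmersion, Scheme.IdealSheafData.one_eq_top,
      Ideal.one_eq_top]
    exact Ideal.map_top ((f.appIso ⊤).hom ≫ (Scheme.ΓSpecIso A).hom).hom
  | succ n ih => rw [pow_succ, idealOn_mul_of_isOpenImmersion, ih, pow_succ]

/-- A chart for the transformation of a couple at a point `w` of the center. -/
structure IsTransformChart {k : Type u} [Field k] (b : ℕ) (C : SchemeWithIdeal k)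
    (I : C.W.IdealSheafData) (w : C.W) {Z : Scheme.{u}} (g : Z ⟶ C.W) : Prop where
  isInvertibleIdeal : IsInvertibleIdeal (I.comap g)
  hom_ext : ∀ {T : Scheme.{u}} (a b : T ⟶ Z), a ≫ g = b ≫ g →
    IsInvertibleIdeal (I.comap (a ≫ g)) → a = b
  smooth : Smooth (g ≫ C.str)
  ordAt_le : ∀ J₁ : Z.IdealSheafData, C.J.comap g = I.comap g ^ b * J₁ →
    ∀ z, g z = w → ordAt J₁ z ≤ b

variable {k : Type u} [Field k] {b : ℕ} {C : SchemeWithIdeal k} {I : C.W.IdealSheafData}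

/-- The open complement of the closed subscheme defined by an ideal sheaf. -/
abbrev complSupport {W : Scheme.{u}} (I : W.IdealSheafData) : W.Opens := I.support.compl

lemma comap_complSupport {W : Scheme.{u}} (I : W.IdealSheafData) :
    I.comap (complSupport I).ι = ⊤ := by
  rw [← Scheme.IdealSheafData.support_eq_bot_iff, Scheme.IdealSheafData.support_comap, eq_bot_iff]
  exact fun z hz ↦ z.2 hz

/-- Off the centre the exceptional ideal is trivial, so the transform is the restriction of `J`. -/
lemma isTransformChart_complSupport [Smooth C.str] {w : C.W} (hw : ordAt C.J w ≤ b) :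
    IsTransformChart b C I w (complSupport I).ι := by
  have h1 := comap_complSupport I
  refine ⟨?_, fun a b h _ ↦ (cancel_mono _).mp h, inferInstance, fun J₁ hJ₁ z hz ↦ ?_⟩
  · rw [h1]
    exact isInvertibleIdeal_top _
  · have h2 : C.J.comap (complSupport I).ι = J₁ := by
      rw [hJ₁, h1, ← Scheme.IdealSheafData.one_eq_top, one_pow, one_mul]
    rw [← h2, ordAt_comap_of_isOpenImmersion, hz]
    exact hw

lemma IsBlowupChart.isTransformChart [CharZero k] {V : C.W.Opens} (hV : IsAffineOpen V)
    [Algebra k Γ(C.W, V)]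
    (hstr : Spec.map (CommRingCat.ofHom (algebraMap k Γ(C.W, V))) = hV.fromSpec ≫ C.str)
    {ι : Type} [DecidableEq ι] {x : ι → Γ(C.W, V)}
    (hI : I.ideal ⟨V, hV⟩ = Ideal.span (Set.range x)) {R : Type u} [CommRing R]
    [Algebra Γ(C.W, V) R] {i : ι} {t : ι → R} (h : IsBlowupChart x i t)
    (hR : ((algebraMap Γ(C.W, V) R).comp (algebraMap k Γ(C.W, V))).Smooth)
    {w : C.W} (hwI : w ∈ I.support) (hw : ordAt C.J w ≤ b) :
    IsTransformChart b C I w (chartMap Γ(C.W, V) R hV.fromSpec) := by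
  have hI' : idealOn hV.fromSpec I = Ideal.span (Set.range x) := by rw [idealOn_fromSpec, hI]
  refine ⟨h.isInvertibleIdeal_comap hI', h.chartMap_hom_ext hI', ?_, fun J₁ hJ₁ z hz ↦ ?_⟩
  · rw [Category.assoc, ← hstr, ← Spec.map_comp]
    exact (HasRingHomProperty.Spec_iff (P := @Smooth)).mpr hR
  · let p := Spec.map (CommRingCat.ofHom (algebraMap Γ(C.W, V) R)) z
    have hpw : hV.fromSpec p = w := hz
    have hzp : z.asIdeal.comap (algebraMap Γ(C.W, V) R) = p.asIdeal := rfl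
    have := p.2
    have := z.2
    have hxp (j : ι) : x j ∈ p.asIdeal := by
      rw [← hpw, fromSpec_mem_support_iff, hI] at hwI
      exact hwI (Ideal.subset_span ⟨j, rfl⟩)
    have : CharZero (Γ(C.W, V) ⧸ p.asIdeal) :=
      charZero_of_injective_algebraMap (algebraMap k _).injective
    have hJ : (C.J.ideal ⟨V, hV⟩).map (algebraMap Γ(C.W, V) R) =
        Ideal.span {algebraMap Γ(C.W, V) R (x i)} ^ b * idealOn (𝟙 (Spec (.of R))) J₁ := by
      have h1 := congr_arg (idealOn (𝟙 (Spec (.of R)))) hJ₁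
      rw [idealOn_mul_of_isOpenImmersion, idealOn_pow_of_isOpenImmersion, idealOn_comap,
        idealOn_comap, Category.id_comp, h.idealOn_chartMap hI', idealOn_SpecMap_comp,
        idealOn_fromSpec] at h1
      exact h1
    rw [← hpw, ← ordAt_comap_of_isOpenImmersion, ordAt_le_iff, le_ordAt_Spec_iff, idealOn_comap,
      Category.id_comp, idealOn_fromSpec] at hw
    push Not at hw
    obtain ⟨f, hfJ, hf⟩ := hw
    -- Multiplier `1`: an element outside the symbolic power is outside the ordinary one.
    have hf1 : f ∉ p.asIdeal ^ (b + 1) := by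
      simpa using hf 1 ((Ideal.ne_top_iff_one _).mp (Ideal.IsPrime.ne_top ‹_›))
    obtain ⟨g, hg, hgz⟩ := h.exists_notMem_pow hxp hzp hJ hfJ hf1
    rw [ordAt_le_iff, le_ordAt_Spec_iff]
    push Not
    exact ⟨g, hg, hgz⟩

/-- A blow-up of a smooth scheme along a smooth center is locally covered by smooth charts. -/
lemma exists_isTransformChart [CharZero k] [Smooth C.str] [Smooth (I.subschemeι ≫ C.str)]
    (hord : ∀ w, ordAt C.J w ≤ b)
    {W₁ : Scheme.{u}} {π : W₁ ⟶ C.W} (hπ : IsBlowup π I) (y : W₁) :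
    ∃ (Z U : Scheme.{u}) (g : Z ⟶ C.W) (j : U ⟶ W₁) (h : U ⟶ Z) (u : U),
      IsTransformChart b C I (π y) g ∧ IsOpenImmersion j ∧ j u = y ∧ h ≫ g = j ≫ π := by
  by_cases hy : π y ∈ I.support
  · obtain ⟨V, hV, _, r, x, hyV, hstr, _, hI, hx⟩ :=
      exists_affineOpens_smooth_coordinates C.str I hy
    choose R _ _ t ht hR using fun i ↦ exists_isBlowupChart (k := k) x i hx
    obtain ⟨i, U, hU, h, hyU, hh⟩ := hπ.exists_lift_chartMap hV hI ht y hyV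
    refine ⟨_, _, _, hU.fromSpec, h, hU.primeIdealOf ⟨y, hyU⟩,
      (ht i).isTransformChart hV hstr hI (hR i) hy (hord _), inferInstance,
      hU.fromSpec_primeIdealOf ⟨y, hyU⟩, hh⟩
  · exact ⟨_, _, _, (π ⁻¹ᵁ complSupport I).ι, π ∣_ complSupport I, ⟨y, hy⟩,
      isTransformChart_complSupport (hord _), inferInstance, rfl, morphismRestrict_ι _ _⟩

section Step
variable {C₁ : SchemeWithIdeal k} {π : C₁.W ⟶ C.W}

lemma IsBlowup.smooth [CharZero k] [Smooth C.str] [Smooth (I.subschemeι ≫ C.str)]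
    (hord : ∀ w, ordAt C.J w ≤ b) (hπ : IsBlowup π I) (hstr : π ≫ C.str = C₁.str) :
    Smooth C₁.str := by
  choose Z U g j h u hg hj hu hh using exists_isTransformChart hord hπ
  have : IsZariskiLocalAtSource @AlgebraicGeometry.Smooth.{u} :=
    HasRingHomProperty.instIsZariskiLocalAtSource
  refine IsZariskiLocalAtSource.of_iSup_eq_top (P := @AlgebraicGeometry.Smooth.{u})
    (fun y ↦ (j y).opensRange) ?_ fun y ↦ ?_
  · rw [eq_top_iff]
    exact fun y _ ↦ TopologicalSpace.Opens.mem_iSup.mpr ⟨y, u y, hu y⟩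
  · obtain ⟨g₁, hg₁, -⟩ := hπ.existsUnique_lift (g y) (hg y).isInvertibleIdeal
    obtain ⟨-, h1⟩ := hπ.comp_lift_eq_and_isOpenImmersion (hg y).isInvertibleIdeal (hg y).hom_ext
      hg₁ (j y) (h y) (hh y)
    have h2 : (j y).opensRange.ι ≫ C₁.str = (j y).isoOpensRange.inv ≫ h y ≫ g y ≫ C.str := by
      rw [← Scheme.Hom.isoOpensRange_inv_comp, Category.assoc, ← hstr, reassoc_of% hh y]
    have := (hg y).smooth
    rw [h2]
    infer_instance

/-- The transformation identity pulls back along the lift of the chart to the blow-up, and pulling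
back does not lower orders. -/
lemma IsBlowup.ordAt_le [CharZero k] [Smooth C.str] [Smooth (I.subschemeι ≫ C.str)]
    (hord : ∀ w, ordAt C.J w ≤ b) (hπ : IsBlowup π I)
    (hJ : C.J.comap π = (I.comap π) ^ b * C₁.J) (y : C₁.W) : ordAt C₁.J y ≤ b := by
  obtain ⟨Z, U, g, j, h, u, hg, hj, rfl, hh⟩ := exists_isTransformChart hord hπ y
  obtain ⟨g₁, hg₁, -⟩ := hπ.existsUnique_lift g hg.isInvertibleIdeal
  obtain ⟨h1, -⟩ := hπ.comp_lift_eq_and_isOpenImmersion hg.isInvertibleIdeal hg.hom_ext hg₁ j h hh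
  rw [← h1]
  refine (ordAt_le_ordAt_comap g₁ C₁.J (h u)).trans (hg.ordAt_le _ ?_ _ ?_)
  · rw [← hg₁, Scheme.IdealSheafData.comap_comp, hJ, comap_mul, comap_pow,
      Scheme.IdealSheafData.comap_comp]
  · rw [← Scheme.Hom.comp_apply, hh]
    rfl

/-- A reduced ring localized at a minimal prime is a field. -/
lemma exists_notMem_mul_eq_zero {A : Type*} [CommRing A] [IsReduced A] {q : Ideal A}
    (hq : q ∈ minimalPrimes A) {f : A} (hf : f ∈ q) : ∃ s ∉ q, s * f = 0 := by
  have := hq.isPrime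
  let L := Localization.AtPrime q
  have h1 := IsLocalization.AtPrime.radical_map_of_mem_minimalPrimes L q ⊥ hq
  have h2 := (IsLocalization.AtPrime.to_map_mem_maximal_iff L q f).mpr hf
  rw [← IsLocalization.AtPrime.map_eq_maximalIdeal q L, ← h1, Ideal.map_bot] at h2
  have h3 : algebraMap A L f = 0 := by simpa using h2
  obtain ⟨s, hs⟩ := (IsLocalization.map_eq_zero_iff q.primeCompl L f).mp h3
  exact ⟨s, s.2, hs⟩

/-- A blow-up of a nonempty smooth scheme along a smooth center is nonempty, unless the ideal sheaf
has infinite order somewhere. -/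
lemma IsBlowup.nonempty [Smooth C.str] [Smooth (I.subschemeι ≫ C.str)] [Nonempty C.W]
    (hb : 0 < b) (hord : ∀ w, ordAt C.J w ≤ b) (hI : (I.support : Set C.W) ⊆ Sing C.J b)
    {W₁ : Scheme.{u}} {π : W₁ ⟶ C.W} (hπ : IsBlowup π I) : Nonempty W₁ := by
  obtain ⟨w⟩ := ‹Nonempty C.W›
  by_cases hw : w ∈ I.support
  · obtain ⟨V, hV, _, r, x, hwV, hstr, _, hIV, hx⟩ :=
      exists_affineOpens_smooth_coordinates C.str I hw
    let p := hV.primeIdealOf ⟨w, hwV⟩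
    have hpw : hV.fromSpec p = w := hV.fromSpec_primeIdealOf ⟨w, hwV⟩
    have hp := (fromSpec_mem_support_iff hV p I).mp (by rwa [hpw])
    have := p.2
    rw [hIV] at hp
    obtain rfl | hr := r.eq_zero_or_pos
    -- With no equations the centre contains all of `V`. At a minimal prime, order at least `1`
    -- means that `J` vanishes locally, so its order is infinite, against the bound `b`.
    · exfalso
      have : IsReduced Γ(C.W, V) := isReduced_of_smooth k _
      obtain ⟨q, hq, -⟩ := Ideal.exists_minimalPrimes_le (bot_le (a := p.asIdeal))
      let q' : Spec Γ(C.W, V) := ⟨q, hq.isPrime⟩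
      have h1 : hV.fromSpec q' ∈ I.support := by
        rw [fromSpec_mem_support_iff, hIV]
        simp
      have h2 : (b : ℕ∞) ≤ ordAt C.J (hV.fromSpec q') := hI h1
      replace h2 : ((1 : ℕ) : ℕ∞) ≤ ordAt C.J (hV.fromSpec q') := (Nat.cast_le.mpr hb).trans h2
      have h3 := hord (hV.fromSpec q')
      rw [← ordAt_comap_of_isOpenImmersion] at h2 h3
      rw [le_ordAt_Spec_iff] at h2
      rw [ordAt_le_iff, le_ordAt_Spec_iff] at h3
      refine h3 fun f hf ↦ ?_
      obtain ⟨s, hs, hsf⟩ := h2 f hf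
      obtain ⟨s', hs', hsf'⟩ := exists_notMem_mul_eq_zero hq
        (((hq.isPrime.mem_or_mem (by simpa using hsf)).resolve_left hs))
      exact ⟨s', hs', hsf' ▸ zero_mem _⟩
    · obtain ⟨R, _, _, t, ht, -⟩ := exists_isBlowupChart (k := k) x ⟨0, hr⟩ hx
      obtain ⟨g₁, -, -⟩ := hπ.existsUnique_lift _ (ht.isInvertibleIdeal_comap (v := hV.fromSpec)
        (by rw [idealOn_fromSpec, hIV]))
      -- The chart specializes onto a polynomial ring over the domain `A ⧸ p`, so it has a point.
      have : Nontrivial R := ht.nontrivial_of_isPrime fun j ↦ hp (Ideal.subset_span ⟨j, rfl⟩)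
      obtain ⟨z⟩ : Nonempty (PrimeSpectrum R) := inferInstance
      exact ⟨g₁ z⟩
  · obtain ⟨g₁, -, -⟩ := hπ.existsUnique_lift (complSupport I).ι
      (by rw [comap_complSupport]; exact isInvertibleIdeal_top _)
    exact ⟨g₁ ⟨w, hw⟩⟩

end Step
end SimpleCouples
end

/-! ### Iteration of the invariant and conclusion. -/

noncomputable section
namespace SimpleCouples
variable {k : Type u} [Field k] {b : ℕ} {C C₁ : SchemeWithIdeal k}

/-- A couple `(J, b)` on a nonempty smooth scheme, such that `J` has order at most `b`. -/
structure HasOrderAtMost (b : ℕ) (C : SchemeWithIdeal k) : Prop where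
  smooth : Smooth C.str
  nonempty : Nonempty C.W
  ordAt_le : ∀ w, ordAt C.J w ≤ b

lemma IsSimpleCouple.hasOrderAtMost (h : IsSimpleCouple b C) : HasOrderAtMost b C :=
  ⟨h.1, Set.range_nonempty_iff_nonempty.mp ⟨_, h.2.2.1⟩, fun w ↦ h.2.2.2 ⟨w, rfl⟩⟩

lemma HasOrderAtMost.of_isTransform [CharZero k] (hb : 0 < b) (h : HasOrderAtMost b C)
    (h₁ : IsTransform b C C₁) : HasOrderAtMost b C₁ := by
  obtain ⟨π, I, hstr, hI, hsub, hπ, hJ⟩ := h₁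
  have := h.smooth
  have := h.nonempty
  exact ⟨hπ.smooth h.ordAt_le hstr, hπ.nonempty hb h.ordAt_le hsub, hπ.ordAt_le h.ordAt_le hJ⟩

lemma HasOrderAtMost.of_isIteratedTransform [CharZero k] (hb : 0 < b) (h : HasOrderAtMost b C)
    (h₁ : IsIteratedTransform b C C₁) : HasOrderAtMost b C₁ := by
  induction h₁ with
  | refl => exact h
  | tail _ h₂ ih => exact ih.of_isTransform hb h₂

lemma HasOrderAtMost.exists_hasMaxOrder (h : HasOrderAtMost b C) :
    ∃ m ≤ b, HasMaxOrder C.J m := by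
  have := h.nonempty
  have hnat (w : C.W) : ∃ n : ℕ, n ≤ b ∧ (n : ℕ∞) = ordAt C.J w := by
    obtain ⟨n, hn⟩ := ENat.ne_top_iff_exists.mp
      (ne_top_of_le_ne_top (ENat.natCast_ne_top b) (h.ordAt_le w))
    exact ⟨n, Nat.cast_le.mp (hn ▸ h.ordAt_le w), hn⟩
  have hfin : (Set.range (ordAt C.J)).Finite :=
    ((Set.finite_Iic b).image ((↑) : ℕ → ℕ∞)).subset (by
      rintro _ ⟨w, rfl⟩
      obtain ⟨n, hnb, hn⟩ := hnat w
      exact ⟨n, hnb, hn⟩)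
  obtain ⟨_, ⟨w, rfl⟩, hw⟩ := hfin.exists_maximal (Set.range_nonempty _)
  obtain ⟨n, hnb, hn⟩ := hnat w
  refine ⟨n, hnb, ⟨w, hn.symm⟩, ?_⟩
  rintro _ ⟨w', rfl⟩
  rw [hn]
  exact (le_total _ _).elim (hw ⟨w', rfl⟩) id

lemma HasOrderAtMost.sing_eq_empty_or_hasMaxOrder (h : HasOrderAtMost b C) :
    Sing C.J b = ∅ ∨ HasMaxOrder C.J b := by
  rw [or_iff_not_imp_left, ← ne_eq, ← Set.nonempty_iff_ne_empty]
  rintro ⟨w, hw⟩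
  exact ⟨⟨w, (h.ordAt_le w).antisymm hw⟩, by rintro _ ⟨w, rfl⟩; exact h.ordAt_le w⟩

lemma eq_top_of_ordAt_eq_zero {X : Scheme.{u}} {J : X.IdealSheafData} (h : ∀ x, ordAt J x = 0) :
    J = ⊤ := by
  refine idealSheafData_ext_of_forall_exists fun x ↦ ?_
  obtain ⟨U, hU, hxU, -⟩ := exists_affineOpens x (V := ⊤) trivial
  refine ⟨⟨U, hU⟩, hxU, ?_⟩
  change J.ideal ⟨U, hU⟩ = ⊤
  by_contra hne
  -- A proper ideal has order at least `1` at any maximal ideal containing it.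
  obtain ⟨p, hp, hle⟩ := Ideal.exists_le_maximal _ hne
  let p' : Spec Γ(X, U) := ⟨p, hp.isPrime⟩
  have h1 := h (hU.fromSpec p')
  rw [← ordAt_comap_of_isOpenImmersion, ← nonpos_iff_eq_zero] at h1
  replace h1 := (ordAt_le_iff _ _ 0).mp h1
  rw [le_ordAt_Spec_iff, idealOn_comap, Category.id_comp, idealOn_fromSpec] at h1
  refine h1 fun f hf ↦ ⟨1, (Ideal.ne_top_iff_one _).mp hp.ne_top, ?_⟩
  simpa using hle hf

end SimpleCouples
end

open SimpleCouples in
theorem theorem72 {k : Type u} [Field k] [CharZero k] (b : ℕ) (C : SchemeWithIdeal k)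
    (hC : IsSimpleCouple b C) :
    (∀ C₁ : SchemeWithIdeal k, IsTransform b C C₁ →
      Sing C₁.J b = ∅ ∨ IsSimpleCouple b C₁) ∧
    (∀ C' : SchemeWithIdeal k, IsIteratedTransform b C C' →
      ∃ m : ℕ, m ≤ b ∧ HasMaxOrder C'.J m) ∧
    (b = 1 → ∀ C' : SchemeWithIdeal k, IsIteratedTransform b C C' →
      HasMaxOrder C'.J 1 ∨ (HasMaxOrder C'.J 0 ∧ C'.J = ⊤)) := by
  have h := hC.hasOrderAtMost
  have hb := hC.2.1
  refine ⟨fun C₁ h₁ ↦ ?_, fun C' h' ↦ (h.of_isIteratedTransform hb h').exists_hasMaxOrder, ?_⟩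
  · have h₂ := h.of_isTransform hb h₁
    exact h₂.sing_eq_empty_or_hasMaxOrder.imp_right fun h₃ ↦ ⟨h₂.smooth, hb, h₃⟩
  · rintro rfl C' h'
    obtain ⟨m, hm, h₂⟩ := (h.of_isIteratedTransform hb h').exists_hasMaxOrder
    interval_cases m
    · refine .inr ⟨h₂, eq_top_of_ordAt_eq_zero fun x ↦ ?_⟩
      exact nonpos_iff_eq_zero.mp (by simpa using h₂.2 ⟨x, rfl⟩)
    · exact .inl h₂
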